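/- **Setting.** There are $N$ items and $M$ user types. An instance is $\theta=(p,y,r)\in\Theta=\Delta_M\times(0,1)^{N\times M}\times\mathbb R^N$ ($p_j$: arrival probabilities, $y_{i,j}$: purchase probabilities, $r_i$: revenues), where $\Delta_n$ is the set of probability vectors of length $n$. A recommendation is $x\in\Delta_N^M$, with $x_{i,j}$ the probability of offering item $i$ to a type-$j$ user. All norms $\|\cdot\|_\infty$ are entrywise. Write $\mathrm{rev}(x,\theta)=\sum_{i,j}r_ip_jy_{i,j}x_{i,j}$. Given are outcome matrices $L(\theta),U(\theta)\in\mathbb R^{N\times M}$, defined for $\theta\in\Theta$, with outcomes $O^I_i(x,\theta)=\sum_jL_{i,j}(\theta)x_{i,j}$ and $O^U_j(x,\theta)=\sum_iU_{i,j}(\theta)x_{i,j}$; a social welfare function $W$ of the vector of item outcomes (possibly normalized by the instance); for each $\theta\in\Theta$ an item-fair solution $f^I(\theta)\in\arg\max_{x\in\Delta_N^M}W(O^I(x,\theta))$ and a user-fair solution $f^U(\theta)$, which offers each type $j$ with probability one an item maximizing $U_{i,j}(\theta)$; and $\delta^I,\delta^U\in[0,1]$. For $\eta\ge0$ let $\mathrm{FAIR}(\theta,\eta)$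 be the problem of maximizing $\mathrm{rev}(x,\theta)$ over $x\in\Delta_N^M$ subject to $O^I_i(x,\theta)\ge\delta^IO^I_i(f^I(\theta),\theta)-\eta$ for all $i$ and $O^U_j(x,\theta)\ge\delta^UO^U_j(f^U(\theta),\theta)-\eta$ for all $j$. **Algorithm FORM, horizon $T$.** Let $$\epsilon_t=\min\{N^{-1},N^{-2/3}t^{-1/3}\},\qquad \Gamma_{p,t}=5\sqrt{\log(3T)/t},\qquad \Gamma_{y,t}=\frac{2\log T}{\sqrt{\epsilon_t\max\{1,\,t/\log T-\sqrt{t\log(T)/2}\}}},$$ and $\eta_t=M\log(T)\max\{\Gamma_{y,t},\Gamma_{p,t}\}$. The revenues $r$ are known. In round $t=1,\dots,T$, with estimated instance $\hat\theta_t=(\hat p_t,\hat y_t,r)$, the algorithm takes an optimal solution $\hat x_t$ of $\mathrm{FAIR}(\hat\theta_t,\eta_t)$ (any element of $\Delta_N^M$ determined by the past if $\hat\theta_t\notin\Theta$ or the problem is infeasible) and sets $x_{t,i,j}=(1-N\epsilon_t)\hat x_{t,i,j}+\epsilon_t$. Given the past, a user of type $J_t=j$ arrives with probability $p_j$, item $I_t=i$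 is offered with probability $x_{t,i,j}$, and it is purchased ($z_t=1$) with probability $y_{i,j}$. Initially $\hat p_{1,j}=1/M$ and $\hat y_{1,i,j}=1/2$. With $n_{j,t}$ the number of type-$j$ arrivals in rounds $1,\dots,t$, the updates are $\hat p_{t+1,j}=n_{j,t}/t$ and $$\hat y_{t+1,i,j}=\frac1{n_{j,t}}\sum_{s\le t,\,J_s=j}\frac{\mathbb 1\{I_s=i,\,z_s=1\}}{x_{s,i,j}},$$ where $\hat y_{t+1,i,j}=1/2$ if $n_{j,t}=0$. **Regrets.** Let $x^\star$ be an optimal solution of $\mathrm{FAIR}(\theta,0)$. Put $\mathcal R(T)=\frac1T\sum_{t=1}^T(\mathrm{rev}(x^\star,\theta)-\mathrm{rev}(x_t,\theta))$ and let $\mathcal R_F(T)$ be the larger of $$\max_i\frac1T\sum_{t=1}^T\big(\delta^IO^I_i(f^I(\theta),\theta)-O^I_i(x_t,\theta)\big)^+\quad\text{and}\quad\max_j\frac1T\sum_{t=1}^T\big(\delta^UO^U_j(f^U(\theta),\theta)-O^U_j(x_t,\theta)\big)^+ .$$ **Theorem.** Let $\theta\in\Theta$ have all $p_j>0$ and let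 $\mathrm{FAIR}(\theta,0)$ be feasible. Suppose there are constants $B,\zeta>0$ such that for every $\tilde\theta\in\Theta$ with $\|\tilde\theta-\theta\|_\infty\le\zeta$, $$\max\{\|U(\theta)-U(\tilde\theta)\|_\infty,\ \|L(\theta)-L(\tilde\theta)\|_\infty,\ \|f^I(\theta)-f^I(\tilde\theta)\|_\infty\}\le B\|\theta-\tilde\theta\|_\infty .$$ Then for every $T$ with $\log T>\max\{(2+\|r\|_\infty)B,\ 1/\min_jp_j\}$, FORM satisfies, up to factors polylogarithmic in $T$, $\mathbb E[\mathcal R(T)]=O(MN^{1/3}T^{-1/3})$ and $\mathbb E[\mathcal R_F(T)]=O(MN^{1/3}T^{-1/3})$; precisely, $$\mathbb E[\mathcal R(T)]\le C\,MN^{1/3}T^{-1/3}(\log T)^{3/2},\qquad \mathbb E[\mathcal R_F(T)]\le C\,MN^{1/3}T^{-1/3}(\log T)^{5/2},$$ where $C$ depends only on $B$, $\zeta$, upper bounds on $\|r\|_\infty,\|L(\theta)\|_\infty,\|U(\theta)\|_\infty$, and a positive lower bound on $\min_{i,j}\min\{y_{i,j},1-y_{i,j}\}$ (in particular not on $M$,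 $N$, $T$). -/

import Mathlib

noncomputable section

namespace FairRec

/-! ### Problem instances, recommendation probabilities, outcomes -/

/-- Real matrices indexed by items `i : Fin N` (rows) and user types `j : Fin M` (columns).
As an iterated function type it carries the entrywise sup norm. -/
abbrev Mat (M N : ℕ) : Type := Fin N → Fin M → ℝ

/-- Parameter triples `θ = (p, y, r)`; the norm of this product type is the entrywise sup norm. -/
abbrev Params (M N : ℕ) : Type := (Fin M → ℝ) × Mat M N × (Fin N → ℝ)

variable {M N : ℕ}

/-- Arrival probabilities `p`. -/
def arrival (θ : Params M N) : Fin M → ℝ := θ.1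

/-- Purchase probabilities `y`. -/
def purchase (θ : Params M N) : Mat M N := θ.2.1

/-- Revenues `r`. -/
def revenue (θ : Params M N) : Fin N → ℝ := θ.2.2

/-- The set `Θ = Δ_M × (0,1)^{N × M} × ℝ^N` of problem instances. -/
def instances (M N : ℕ) : Set (Params M N) :=
  {θ | arrival θ ∈ stdSimplex ℝ (Fin M) ∧ ∀ i j, purchase θ i j ∈ Set.Ioo (0 : ℝ) 1}

/-- The set `Δ_N^M` of recommendation probabilities: every column is a probability vector. -/
def policies (M N : ℕ) : Set (Mat M N) :=
  {x | ∀ j, (fun i => x i j) ∈ stdSimplex ℝ (Fin N)}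

/-- Expected revenue `rev(x, θ) = ∑ r_i p_j y_{i,j} x_{i,j}`. -/
def rev (x : Mat M N) (θ : Params M N) : ℝ :=
  ∑ i, ∑ j, revenue θ i * arrival θ j * purchase θ i j * x i j

/-- Outcome of item `i` for the item outcome matrix `L`: the inner product of `i`-th rows. -/
def itemOutcome (L x : Mat M N) (i : Fin N) : ℝ := ∑ j, L i j * x i j

/-- Outcome of a type-`j` user for the user outcome matrix `U`: the inner product of
`j`-th columns. -/
def userOutcome (U x : Mat M N) (j : Fin M) : ℝ := ∑ i, U i j * x i j

/-- `f` is an item-fair solution: a maximizer over `Δ_N^M` of the welfare `W` of the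
vector of item outcomes. -/
def IsItemFair (L : Mat M N) (W : (Fin N → ℝ) → ℝ) (f : Mat M N) : Prop :=
  f ∈ policies M N ∧ ∀ x ∈ policies M N, W (itemOutcome L x) ≤ W (itemOutcome L f)

/-- `f` is a user-fair solution: each user type is offered, with probability one, an item of
maximal outcome. -/
def IsUserFair (U f : Mat M N) : Prop :=
  ∀ j, ∃ k, (∀ i, U i j ≤ U k j) ∧ ∀ i, f i j = if i = k then 1 else 0

/-- What the platform fixes in advance: outcome matrices as functions of the instance, the items'
social welfare function (which may be normalized by the instance, as in the
Kalai-Smorodinsky notion), the single-sided fair solutions they induce, and the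
fairness parameters. -/
structure Spec (M N : ℕ) where
  /-- item outcome matrix -/
  L : Params M N → Mat M N
  /-- user outcome matrix -/
  U : Params M N → Mat M N
  /-- social welfare function of the items -/
  W : Params M N → (Fin N → ℝ) → ℝ
  /-- item-fair solution -/
  fI : Params M N → Mat M N
  /-- user-fair solution -/
  fU : Params M N → Mat M N
  /-- item fairness parameter -/
  δI : ℝ
  /-- user fairness parameter -/
  δU : ℝ
  itemFair : ∀ θ ∈ instances M N, IsItemFair (L θ) (W θ) (fI θ)
  userFair : ∀ θ ∈ instances M N, IsUserFair (U θ) (fU θ)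
  δI_mem : δI ∈ Set.Icc (0 : ℝ) 1
  δU_mem : δU ∈ Set.Icc (0 : ℝ) 1

/-- The point `x` satisfies the constraints of the fair recommendation problem at `θ`, all fairness
constraints being relaxed by `η`. -/
def Feasible (S : Spec M N) (θ : Params M N) (η : ℝ) (x : Mat M N) : Prop :=
  x ∈ policies M N ∧
    (∀ i, S.δI * itemOutcome (S.L θ) (S.fI θ) i - η ≤ itemOutcome (S.L θ) x i) ∧
    (∀ j, S.δU * userOutcome (S.U θ) (S.fU θ) j - η ≤ userOutcome (S.U θ) x j)

/-- The point `x` is an optimal solution of the fair recommendation problem at `θ` relaxed by `η`;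
`η = 0` is the problem without relaxation. -/
def IsOptimal (S : Spec M N) (θ : Params M N) (η : ℝ) (x : Mat M N) : Prop :=
  Feasible S θ η x ∧ ∀ x', Feasible S θ η x' → rev x' θ ≤ rev x θ

/-- Local Lipschitz condition at `θ` with constant `B` on the ball of radius `ζ` in `Θ`, for
the user outcomes, the item outcomes and the item-fair solution. -/
def LocallyLipschitz (S : Spec M N) (θ : Params M N) (B ζ : ℝ) : Prop :=
  ∀ θ' ∈ instances M N, ‖θ' - θ‖ ≤ ζ →
    ‖S.U θ - S.U θ'‖ ≤ B * ‖θ - θ'‖ ∧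
    ‖S.L θ - S.L θ'‖ ≤ B * ‖θ - θ'‖ ∧
    ‖S.fI θ - S.fI θ'‖ ≤ B * ‖θ - θ'‖

/-! ### The algorithm FORM with horizon `T` -/

/-- Exploration magnitude `ε_t` at round `t ≥ 1`. -/
def explore (N t : ℕ) : ℝ :=
  min ((N : ℝ)⁻¹) ((N : ℝ) ^ (-(2 / 3) : ℝ) * (t : ℝ) ^ (-(1 / 3) : ℝ))

/-- Confidence radius `Γ_{y,t}` for the purchase probabilities. -/
def radiusY (N T t : ℕ) : ℝ :=
  2 * Real.log T /
    √(explore N t * max 1 ((t : ℝ) / Real.log T - √((t : ℝ) * Real.log T / 2)))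

/-- Confidence radius `Γ_{p,t}` for the arrival probabilities. -/
def radiusP (T t : ℕ) : ℝ := 5 * √(Real.log (3 * T) / t)

/-- Relaxation magnitude `η_t`. -/
def relax (M N T t : ℕ) : ℝ := M * Real.log T * max (radiusY N T t) (radiusP T t)

/-- What is observed in one round: the user's type `J_t`, the offered item `I_t`, and the purchase
decision `z_t`. -/
abbrev Obs (M N : ℕ) : Type := Fin M × Fin N × Bool

/-- A log entry of the algorithm: the observation of a round and the recommendation probabilities
used in it. Logs are lists of entries, most recent round first. -/
abbrev Entry (M N : ℕ) : Type := Obs M N × Mat M N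

/-- Number `n_j` of type-`j` arrivals in a log. -/
def arrivals (R : List (Entry M N)) (j : Fin M) : ℕ := R.countP (fun e => e.1.1 = j)

/-- Estimated arrival probabilities: uniform at the start, then the empirical frequencies. -/
def arrivalEst (R : List (Entry M N)) (j : Fin M) : ℝ :=
  if R.length = 0 then 1 / (M : ℝ) else (arrivals R j : ℝ) / R.length

/-- Inverse-probability-weighted estimate of the purchase probabilities: the average, over the
rounds with a type-`j` arrival, of `𝟙{I = i, z = 1} / x_{i,j}`. The initial value `1/2` is kept as
long as no type-`j` user has arrived. -/
def purchaseEst (R : List (Entry M N)) (i : Fin N) (j : Fin M) : ℝ :=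
  if arrivals R j = 0 then 1 / 2 else
    (1 / (arrivals R j : ℝ)) *
      (R.map (fun e => if e.1 = (j, i, true) then 1 / e.2 i j else 0)).sum

/-- The estimated instance (revenues `r` are known to the platform). -/
def estimate (r : Fin N → ℝ) (R : List (Entry M N)) : Params M N :=
  (arrivalEst R, purchaseEst R, r)

/-- The map `sol`, from the log so far to the next `x̂_t`, solves the relaxed problem at the estimated
instance. It is an arbitrary element of `Δ_N^M` if the estimate lies outside `Θ` (where outcomes
and fair solutions are not defined) or if the relaxed problem is infeasible. -/
def SolvesRelaxed (S : Spec M N) (r : Fin N → ℝ) (T : ℕ)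
    (sol : List (Entry M N) → Mat M N) : Prop :=
  ∀ R : List (Entry M N), sol R ∈ policies M N ∧
    (estimate r R ∈ instances M N →
      (∃ x, Feasible S (estimate r R) (relax M N T (R.length + 1)) x) →
      IsOptimal S (estimate r R) (relax M N T (R.length + 1)) (sol R))

/-- Randomized exploration: `x_t = (1 - N ε_t) x̂_t + ε_t` in round `t = R.length + 1`. -/
def nextRec (sol : List (Entry M N) → Mat M N) (R : List (Entry M N)) : Mat M N :=
  fun i j => (1 - N * explore N (R.length + 1)) * sol R i j + explore N (R.length + 1)

/-- The log that the algorithm has written after a sequence of observations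
(most recent first). -/
def formLog (sol : List (Entry M N) → Mat M N) : List (Obs M N) → List (Entry M N)
  | [] => []
  | o :: h => (o, nextRec sol (formLog sol h)) :: formLog sol h

/-- The recommendation probabilities that FORM uses in the round after the observations `h`. -/
def recAfter (sol : List (Entry M N) → Mat M N) (h : List (Obs M N)) : Mat M N :=
  nextRec sol (formLog sol h)

/-! ### The random run and its regrets -/

/-- The first `t` observations of the process `o`, most recent first (`o t` belongs to
round `t + 1`). -/
def hist {Ω : Type*} (o : ℕ → Ω → Obs M N) : ℕ → Ω → List (Obs M N)
  | 0, _ => []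
  | t + 1, ω => o t ω :: hist o t ω

/-- The process `o` has the law of `T` rounds of FORM under `θ`: given the past, a user of type `j`
arrives with probability `p_j`, item `i` is then offered with probability `x_{t,i,j}`, and it
is then purchased with probability `y_{i,j}`. -/
structure IsRun {Ω : Type*} [MeasurableSpace Ω] (P : MeasureTheory.Measure Ω) (θ : Params M N)
    (T : ℕ) (sol : List (Entry M N) → Mat M N) (o : ℕ → Ω → Obs M N) : Prop where
  measurable : ∀ t < T, Measurable (o t)
  law : ∀ t < T, ∀ (h : List (Obs M N)) (j : Fin M) (i : Fin N) (z : Bool),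
    P {ω | hist o t ω = h ∧ o t ω = (j, i, z)} =
      P {ω | hist o t ω = h} *
        ENNReal.ofReal (arrival θ j * recAfter sol h i j *
          (if z then purchase θ i j else 1 - purchase θ i j))

/-- Time-averaged revenue regret of the recommendations `x 0, …, x (T - 1)` against `xs`. -/
def revenueRegret (θ : Params M N) (T : ℕ) (xs : Mat M N) (x : ℕ → Mat M N) : ℝ :=
  (1 / (T : ℝ)) * ∑ t ∈ Finset.range T, (rev xs θ - rev (x t) θ)

/-- Maximal time-averaged violation of an item-fairness constraint. -/
def itemFairnessRegret (S : Spec M N) (θ : Params M N) (T : ℕ) (x : ℕ → Mat M N) : ℝ :=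
  ⨆ i : Fin N, (1 / (T : ℝ)) * ∑ t ∈ Finset.range T,
    max (S.δI * itemOutcome (S.L θ) (S.fI θ) i - itemOutcome (S.L θ) (x t) i) 0

/-- Maximal time-averaged violation of a user-fairness constraint. -/
def userFairnessRegret (S : Spec M N) (θ : Params M N) (T : ℕ) (x : ℕ → Mat M N) : ℝ :=
  ⨆ j : Fin M, (1 / (T : ℝ)) * ∑ t ∈ Finset.range T,
    max (S.δU * userOutcome (S.U θ) (S.fU θ) j - userOutcome (S.U θ) (x t) j) 0

/-- Fairness regret. -/
def fairnessRegret (S : Spec M N) (θ : Params M N) (T : ℕ) (x : ℕ → Mat M N) : ℝ :=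
  max (itemFairnessRegret S θ T x) (userFairnessRegret S θ T x)

end FairRec

end

noncomputable section

namespace FairRec

open MeasureTheory

variable {M N : ℕ}

/-! ### Exploration -/

/-! The whole argument is measured against `rate`, that is, $\rho_t=N^{1/3}t^{-1/3}(\log T)^{3/2}$
in round $t$. Rounds in which $\rho_t$ is not below a constant $c$ cost at most a trivial bound
$K\le(K/c)\rho_t$. In the other rounds $\rho_t\ge T^{-1/3}$ forces $\log T$ to be as large as
needed, $N\le t$ holds, and $\epsilon_t$ equals $N^{-2/3}t^{-1/3}$.

Concentration. The arrival counts and the inverse-probability-weighted purchase sums give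
exponential supermartingales along the run. The purchase compensator is proportional to the random
count $n_{j,t}$, so no conditioning on the counts is needed. A weighted sum of these exponentials,
`failure`, has mean at most $4M/T$, and wherever it is below one all estimates are accurate. Since
$p_j\ge1/\log T$, each type then has at least $t/(2\log T)$ arrivals among $t$ users, and
`norm_estimate_sub_le` bounds the error of the estimated instance by $O(\rho_t)$.

Sensitivity. By the Lipschitz condition, replacing $\theta$ by the estimate moves each fairness
constraint by at most $\eta_t$. Hence $x^\star$ is feasible for the relaxed problem, and $\hat x_t$
earns at least as much at the estimate; returning to $\theta$ costs $O(M\rho_t)$ in revenue and at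
most $2\eta_t=O(M\log T\,\rho_t)$ in each constraint (`accurate_round`). Exploration moves mass at
most of order $N\epsilon_t\le\rho_t$ per user type.

Averaging $t^{-1/3}$ over the rounds gives $T^{-1/3}$. The fairness bound has one more logarithm
because $\eta_t$ carries a factor $\log T$; that factor also absorbs the extra $M\le\log T$ produced
by the trivial bound on item outcomes. -/

lemma explore_pos (hN : 0 < N) (t : ℕ) : 0 < explore N (t + 1) := by
  unfold explore; positivity

lemma explore_le_inv (N t : ℕ) : explore N t ≤ (N : ℝ)⁻¹ := min_le_left _ _

lemma mul_explore_le_one (hN : 0 < N) (t : ℕ) : N * explore N t ≤ 1 := by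
  have hN' : (0 : ℝ) < N := by exact_mod_cast hN
  calc N * explore N t ≤ N * (N : ℝ)⁻¹ := by gcongr; exact explore_le_inv N t
    _ = 1 := mul_inv_cancel₀ hN'.ne'

lemma explore_le_one (hN : 0 < N) (t : ℕ) : explore N (t + 1) ≤ 1 := by
  have h := mul_explore_le_one hN (t + 1)
  have hN' : (1 : ℝ) ≤ N := by exact_mod_cast hN
  nlinarith [explore_pos hN t]

lemma explore_anti (N : ℕ) {s t : ℕ} (hst : s ≤ t) : explore N (t + 1) ≤ explore N (s + 1) := by
  unfold explore
  refine min_le_min le_rfl ?_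
  gcongr ?_ * ?_
  refine Real.rpow_le_rpow_of_nonpos (by positivity) (by exact_mod_cast Nat.succ_le_succ hst)
    (by norm_num)

lemma nextRec_mem_policies (hN : 0 < N) {sol : List (Entry M N) → Mat M N}
    {R : List (Entry M N)} (h : sol R ∈ policies M N) : nextRec sol R ∈ policies M N := by
  intro j
  have hN' : (N : ℝ) ≠ 0 := by positivity
  refine ⟨fun i => ?_, ?_⟩
  · have h1 := (h j).1 i
    have h2 := mul_explore_le_one hN (R.length + 1)
    have h3 := explore_pos hN R.length
    simp only [nextRec] at *
    nlinarith
  · have h1 := (h j).2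
    simp only [nextRec]
    rw [Finset.sum_add_distrib, ← Finset.mul_sum, h1]
    simp

lemma explore_le_nextRec (hN : 0 < N) {sol : List (Entry M N) → Mat M N}
    {R : List (Entry M N)} (h : sol R ∈ policies M N) (i : Fin N) (j : Fin M) :
    explore N (R.length + 1) ≤ nextRec sol R i j := by
  have h1 : 0 ≤ sol R i j := (h j).1 i
  have h2 := mul_explore_le_one hN (R.length + 1)
  simp only [nextRec]
  nlinarith

@[simp] lemma length_formLog (sol : List (Entry M N) → Mat M N) (h : List (Obs M N)) :
    (formLog sol h).length = h.length := by
  induction h with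
  | nil => rfl
  | cons o h ih => simp [formLog, ih]

@[simp] lemma length_hist {Ω : Type*} (o : ℕ → Ω → Obs M N) (t : ℕ) (ω : Ω) :
    (hist o t ω).length = t := by
  induction t with
  | zero => rfl
  | succ t ih => simp [hist, ih]

/-! ### One-step law -/

/-- Conditional probability of an observation, given the recommendation probabilities `x`. -/
def stepProb (θ : Params M N) (x : Mat M N) (o : Obs M N) : ℝ :=
  arrival θ o.1 * x o.2.1 o.1 *
    (if o.2.2 then purchase θ o.2.1 o.1 else 1 - purchase θ o.2.1 o.1)

lemma stepProb_nonneg {θ : Params M N} (hθ : θ ∈ instances M N) {x : Mat M N}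
    (hx : x ∈ policies M N) (o : Obs M N) : 0 ≤ stepProb θ x o := by
  obtain ⟨j, i, z⟩ := o
  have h1 : 0 ≤ arrival θ j := hθ.1.1 j
  have h2 : 0 ≤ x i j := (hx j).1 i
  have h3 := hθ.2 i j
  unfold stepProb
  refine mul_nonneg (mul_nonneg h1 h2) ?_
  split_ifs
  · exact h3.1.le
  · exact sub_nonneg.2 h3.2.le

/-- The arrival type has marginal law `p`. -/
lemma sum_stepProb_mul (θ : Params M N) {x : Mat M N} (hx : x ∈ policies M N)
    (g : Fin M → ℝ) : ∑ o : Obs M N, stepProb θ x o * g o.1 = ∑ j, arrival θ j * g j := by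
  rw [Fintype.sum_prod_type]
  refine Finset.sum_congr rfl fun j _ => ?_
  rw [Fintype.sum_prod_type]
  have h : ∑ i, x i j = 1 := (hx j).2
  have : ∀ i, ∑ z : Bool, stepProb θ x (j, i, z) * g j = arrival θ j * g j * x i j := by
    intro i
    simp only [stepProb, Fintype.sum_bool, if_true, Bool.false_eq_true, if_false]
    ring
  simp only [this]
  rw [← Finset.mul_sum, h, mul_one]

/-! ### Expectations along a run -/

/-- All observation sequences of length `t`. -/
def histories (M N : ℕ) : ℕ → Finset (List (Obs M N))
  | 0 => {[]}
  | t + 1 => (Finset.univ ×ˢ histories M N t).image fun a => a.1 :: a.2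

lemma sum_histories_succ (t : ℕ) (f : List (Obs M N) → ℝ) :
    ∑ h ∈ histories M N (t + 1), f h = ∑ h ∈ histories M N t, ∑ o, f (o :: h) := by
  rw [histories, Finset.sum_image, Finset.sum_product_right]
  rintro ⟨a, b⟩ _ ⟨c, d⟩ _ h
  simpa using h

lemma hist_mem_histories {Ω : Type*} (o : ℕ → Ω → Obs M N) (t : ℕ) (ω : Ω) :
    hist o t ω ∈ histories M N t := by
  induction t with
  | zero => simp [hist, histories]
  | succ t ih => simp [hist, histories, ih]

/-- Only finitely many histories of a given length exist, so an expectation along the run is a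
finite sum and every function of the history is integrable. -/
lemma comp_hist_eq_sum {Ω : Type*} (o : ℕ → Ω → Obs M N) (t : ℕ) (f : List (Obs M N) → ℝ) (ω : Ω) :
    f (hist o t ω) = ∑ h ∈ histories M N t, {ω | hist o t ω = h}.indicator (fun _ => f h) ω := by
  rw [Finset.sum_eq_single (hist o t ω)]
  · simp
  · intro b _ hb
    simp [hb.symm]
  · intro hn
    exact absurd (hist_mem_histories o t ω) hn

section Run

variable {Ω : Type*} [MeasurableSpace Ω] {P : Measure Ω} {θ : Params M N} {T : ℕ}
  {sol : List (Entry M N) → Mat M N} {o : ℕ → Ω → Obs M N}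

lemma measurableSet_hist_eq (hrun : IsRun P θ T sol o) {t : ℕ} (ht : t ≤ T)
    (h : List (Obs M N)) : MeasurableSet {ω | hist o t ω = h} := by
  induction t generalizing h with
  | zero => by_cases hh : ([] : List (Obs M N)) = h <;> simp [hist, hh]
  | succ t ih =>
    cases h with
    | nil => simp [hist]
    | cons a h =>
      have : {ω | hist o (t + 1) ω = a :: h} = o t ⁻¹' {a} ∩ {ω | hist o t ω = h} := by
        ext ω; simp [hist]
      rw [this]
      exact (hrun.measurable t ht (measurableSet_singleton a)).inter (ih (by omega) h)

lemma integrable_comp_hist [IsFiniteMeasure P] (hrun : IsRun P θ T sol o) {t : ℕ} (ht : t ≤ T)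
    (f : List (Obs M N) → ℝ) : Integrable (fun ω => f (hist o t ω)) P := by
  simp only [comp_hist_eq_sum o t f]
  exact integrable_finsetSum _ fun h _ =>
    (integrable_const (f h)).indicator (measurableSet_hist_eq hrun ht h)

lemma integral_comp_hist [IsFiniteMeasure P] (hrun : IsRun P θ T sol o) {t : ℕ} (ht : t ≤ T)
    (f : List (Obs M N) → ℝ) :
    ∫ ω, f (hist o t ω) ∂P = ∑ h ∈ histories M N t, P.real {ω | hist o t ω = h} * f h := by
  simp only [comp_hist_eq_sum o t f]
  rw [integral_finsetSum _ fun h _ =>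
    (integrable_const (f h)).indicator (measurableSet_hist_eq hrun ht h)]
  refine Finset.sum_congr rfl fun h _ => ?_
  rw [integral_indicator_const _ (measurableSet_hist_eq hrun ht h), smul_eq_mul]

lemma IsRun.measureReal_hist_succ (hrun : IsRun P θ T sol o) (hθ : θ ∈ instances M N)
    (hN : 0 < N) (hsol : ∀ R, sol R ∈ policies M N) {t : ℕ} (ht : t < T)
    (h : List (Obs M N)) (a : Obs M N) :
    P.real {ω | hist o (t + 1) ω = a :: h} =
      P.real {ω | hist o t ω = h} * stepProb θ (recAfter sol h) a := by
  have hset : {ω | hist o (t + 1) ω = a :: h} = {ω | hist o t ω = h ∧ o t ω = a} := by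
    ext ω; simp [hist, and_comm]
  have h0 := stepProb_nonneg hθ (nextRec_mem_policies hN (hsol (formLog sol h))) a
  obtain ⟨j, i, z⟩ := a
  rw [Measure.real, hset, hrun.law t ht h j i z, ENNReal.toReal_mul, ENNReal.toReal_ofReal]
  · rfl
  · exact h0

/-- A function of the history that does not increase in conditional mean over the first `t`
rounds has, after these rounds, an expectation of at most its initial value. -/
lemma IsRun.integral_le_of_step_le [IsProbabilityMeasure P] (hrun : IsRun P θ T sol o)
    (hθ : θ ∈ instances M N) (hN : 0 < N) (hsol : ∀ R, sol R ∈ policies M N)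
    (f : List (Obs M N) → ℝ) {t : ℕ} (ht : t ≤ T)
    (hf : ∀ h : List (Obs M N), h.length < t →
      ∑ a, stepProb θ (recAfter sol h) a * f (a :: h) ≤ f h) :
    ∫ ω, f (hist o t ω) ∂P ≤ f [] := by
  induction t with
  | zero => simp [hist]
  | succ t ih =>
    refine le_trans ?_ (ih (by omega) fun h hh => hf h (by omega))
    rw [integral_comp_hist hrun ht, integral_comp_hist hrun (by omega : t ≤ T),
      sum_histories_succ]
    refine Finset.sum_le_sum fun h hh => ?_
    simp only [hrun.measureReal_hist_succ hθ hN hsol ht, mul_assoc]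
    rw [← Finset.mul_sum]
    -- The step hypothesis speaks of the length of `h`; a list of any other length than `t` cannot
    -- occur as the history, so its term vanishes.
    by_cases hl : h.length = t
    · exact mul_le_mul_of_nonneg_left (hf h (by omega)) measureReal_nonneg
    · have : {ω | hist o t ω = h} = ∅ := by
        ext ω
        simp only [Set.mem_ofPred_eq, Set.mem_empty_iff_false, iff_false]
        rintro rfl
        simp at hl
      simp [this]

end Run

/-! ### Exponential supermartingales -/

lemma exp_le_one_add_add_sq {u : ℝ} (hu : |u| ≤ 1) : Real.exp u ≤ 1 + u + u ^ 2 := by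
  have := (abs_le.1 (Real.abs_exp_sub_one_sub_id_le hu)).2
  linarith

/-- With $e^u\le1+u+u^2$ the linear term has mean zero and the quadratic one is $l^2$ times the
variance $p(1-p)\le1$, which the compensator $l^2$ pays for. -/
lemma sum_stepProb_exp_arrival_le {θ : Params M N} (hθ : θ ∈ instances M N) {x : Mat M N}
    (hx : x ∈ policies M N) (j : Fin M) {l : ℝ} (hl : |l| ≤ 1) :
    ∑ o : Obs M N, stepProb θ x o *
      Real.exp (l * ((if o.1 = j then 1 else 0) - arrival θ j) - l ^ 2) ≤ 1 := by
  have hp0 : ∀ k, 0 ≤ arrival θ k := hθ.1.1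
  have hp1 : ∑ k, arrival θ k = 1 := hθ.1.2
  have hpj : arrival θ j ≤ 1 := hp1 ▸ Finset.single_le_sum (fun k _ => hp0 k) (Finset.mem_univ j)
  rw [sum_stepProb_mul θ hx
    (fun k => Real.exp (l * ((if k = j then 1 else 0) - arrival θ j) - l ^ 2))]
  set p := arrival θ j with hp
  have key : ∀ k, Real.exp (l * ((if k = j then 1 else 0) - p) - l ^ 2) ≤
      Real.exp (-l ^ 2) * (1 - l * p + l ^ 2 * p ^ 2 +
        (if k = j then l + l ^ 2 * (1 - 2 * p) else 0)) := by
    intro k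
    rw [show l * ((if k = j then (1 : ℝ) else 0) - p) - l ^ 2 =
      -l ^ 2 + l * ((if k = j then 1 else 0) - p) by ring, Real.exp_add]
    refine mul_le_mul_of_nonneg_left ((exp_le_one_add_add_sq ?_).trans_eq ?_) (Real.exp_pos _).le
    · rw [abs_mul]
      refine mul_le_one₀ hl (abs_nonneg _) (abs_le.2 ?_)
      have := hp0 j
      split_ifs <;> constructor <;> linarith
    · split_ifs <;> ring
  calc ∑ k, arrival θ k * Real.exp (l * ((if k = j then 1 else 0) - p) - l ^ 2)
      ≤ ∑ k, arrival θ k * (Real.exp (-l ^ 2) * (1 - l * p + l ^ 2 * p ^ 2 +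
        (if k = j then l + l ^ 2 * (1 - 2 * p) else 0))) :=
        Finset.sum_le_sum fun k _ => mul_le_mul_of_nonneg_left (key k) (hp0 k)
    _ = Real.exp (-l ^ 2) * ((∑ k, arrival θ k) * (1 - l * p + l ^ 2 * p ^ 2) +
        ∑ k, arrival θ k * (if k = j then l + l ^ 2 * (1 - 2 * p) else 0)) := by
        rw [Finset.sum_mul, ← Finset.sum_add_distrib, Finset.mul_sum]
        exact Finset.sum_congr rfl fun k _ => by ring
    _ = Real.exp (-l ^ 2) * (1 + l ^ 2 * (p * (1 - p))) := by
        rw [hp1]; simp only [mul_ite, mul_zero, Finset.sum_ite_eq', Finset.mem_univ, if_true]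
        rw [← hp]; ring
    _ ≤ Real.exp (-l ^ 2) * Real.exp (l ^ 2) := by
        refine mul_le_mul_of_nonneg_left ?_ (Real.exp_pos _).le
        have := Real.add_one_le_exp (l ^ 2)
        have h2 : p * (1 - p) ≤ 1 := by nlinarith [hp0 j]
        nlinarith [sq_nonneg l]
    _ = 1 := by rw [← Real.exp_add]; simp

/-- The weighted purchase is unbiased given the type, and its conditional variance $y/x-y^2$ is at
most $1/e$. Tilts up to $e$ keep the exponent in $[-1,1]$ before compensation. Compensating only
when type $j$ arrives makes the total compensator proportional to the number of arrivals. -/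
lemma sum_stepProb_exp_purchase_le {θ : Params M N} (hθ : θ ∈ instances M N) {x : Mat M N}
    (hx : x ∈ policies M N) (i : Fin N) (j : Fin M) {e l : ℝ} (he : 0 < e) (he1 : e ≤ 1)
    (hex : e ≤ x i j) (hl : |l| ≤ e) :
    ∑ o : Obs M N, stepProb θ x o *
      Real.exp (l * ((if o = (j, i, true) then 1 / x i j else 0) -
        purchase θ i j * (if o.1 = j then 1 else 0)) -
          l ^ 2 / e * (if o.1 = j then 1 else 0)) ≤ 1 := by
  have hp0 : ∀ k, 0 ≤ arrival θ k := hθ.1.1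
  have hp1 : ∑ k, arrival θ k = 1 := hθ.1.2
  have hy := hθ.2 i j
  set y := purchase θ i j with hydef
  set p := arrival θ j with hp
  have hxpos : 0 < x i j := he.trans_le hex
  set c := 1 / x i j with hc
  have hc0 : 0 < c := by positivity
  have hce : c ≤ 1 / e := one_div_le_one_div_of_le he hex
  have hle : |l| * (1 / e) ≤ 1 := by rw [mul_one_div]; exact (div_le_one he).2 hl
  have he1' : 1 ≤ 1 / e := (one_le_div he).2 he1
  set b := Real.exp (-(l ^ 2 / e)) with hb
  -- For another type both sides are one. For type $j$ the square expands without cross terms beyond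
  -- the indicator itself, since an indicator is idempotent.
  have key : ∀ o : Obs M N, Real.exp (l * ((if o = (j, i, true) then c else 0) -
      y * (if o.1 = j then 1 else 0)) - l ^ 2 / e * (if o.1 = j then 1 else 0)) ≤
      1 + (if o.1 = j then b * (1 - l * y + l ^ 2 * y ^ 2) - 1 else 0) +
        (if o = (j, i, true) then b * (l * c + l ^ 2 * (c ^ 2 - 2 * y * c)) else 0) := by
    intro o
    by_cases hj : o.1 = j
    · simp only [hj, if_true, mul_one]
      rw [show ∀ u : ℝ, u - l ^ 2 / e = -(l ^ 2 / e) + u by intro u; ring, Real.exp_add, ← hb]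
      have habs : |l * ((if o = (j, i, true) then c else 0) - y)| ≤ 1 := by
        rw [abs_mul]
        refine (mul_le_mul_of_nonneg_left (abs_le.2 ?_) (abs_nonneg l)).trans hle
        split_ifs <;> constructor <;> linarith [hy.1, hy.2]
      refine (mul_le_mul_of_nonneg_left (exp_le_one_add_add_sq habs)
        (Real.exp_pos _).le).trans_eq ?_
      split_ifs <;> ring
    · have : o ≠ (j, i, true) := by rintro rfl; exact hj rfl
      simp [hj, this]
  have hb0 : 0 < b := Real.exp_pos _
  calc _ ≤ ∑ o : Obs M N, stepProb θ x o *
      (1 + (if o.1 = j then b * (1 - l * y + l ^ 2 * y ^ 2) - 1 else 0) +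
        (if o = (j, i, true) then b * (l * c + l ^ 2 * (c ^ 2 - 2 * y * c)) else 0)) :=
        Finset.sum_le_sum fun o _ => mul_le_mul_of_nonneg_left (key o) (stepProb_nonneg hθ hx o)
    _ = ∑ o : Obs M N, stepProb θ x o *
          (1 + (if o.1 = j then b * (1 - l * y + l ^ 2 * y ^ 2) - 1 else 0)) +
        ∑ o : Obs M N, stepProb θ x o *
          (if o = (j, i, true) then b * (l * c + l ^ 2 * (c ^ 2 - 2 * y * c)) else 0) := by
        rw [← Finset.sum_add_distrib]
        exact Finset.sum_congr rfl fun o _ => by ring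
    _ = 1 + p * (b * (1 - l * y + l ^ 2 * y ^ 2) - 1) +
          p * x i j * y * (b * (l * c + l ^ 2 * (c ^ 2 - 2 * y * c))) := by
        rw [sum_stepProb_mul θ hx
          (fun k => 1 + (if k = j then b * (1 - l * y + l ^ 2 * y ^ 2) - 1 else 0))]
        simp only [mul_add, mul_one, Finset.sum_add_distrib, hp1, mul_ite, mul_zero,
          Finset.sum_ite_eq', Finset.mem_univ, if_true]
        simp only [stepProb, if_true]
        ring
    _ = 1 + p * (b * (1 + l ^ 2 * (y * c - y ^ 2)) - 1) := by
        -- Unbiasedness: the weight $c=1/x$ cancels the offer probability, and with it the terms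
        -- linear in $l$.
        have : x i j * c = 1 := mul_one_div_cancel hxpos.ne'
        linear_combination (p * y * b * (l + l ^ 2 * (c - 2 * y))) * this
    _ ≤ 1 := by
        have h1 : b * (1 + l ^ 2 * (y * c - y ^ 2)) ≤ 1 := by
          calc b * (1 + l ^ 2 * (y * c - y ^ 2)) ≤ b * Real.exp (l ^ 2 / e) := by
                refine mul_le_mul_of_nonneg_left ?_ hb0.le
                have h2 := Real.add_one_le_exp (l ^ 2 / e)
                have h3 : y * c - y ^ 2 ≤ 1 / e := by nlinarith [hy.1, hy.2]
                have h4 := mul_le_mul_of_nonneg_left h3 (sq_nonneg l)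
                have h5 : l ^ 2 * (1 / e) = l ^ 2 / e := mul_one_div _ _
                linarith
            _ = 1 := by rw [hb, ← Real.exp_add]; simp
        nlinarith [hp0 j]

/-- Sum of the centred inverse-probability-weighted purchases of item `i` by type-`j` users. -/
def purchaseDev (θ : Params M N) (i : Fin N) (j : Fin M) (R : List (Entry M N)) : ℝ :=
  (R.map fun e => (if e.1 = (j, i, true) then 1 / e.2 i j else 0) -
    purchase θ i j * (if e.1.1 = j then 1 else 0)).sum

lemma arrivals_cons (e : Entry M N) (R : List (Entry M N)) (j : Fin M) :
    (arrivals (e :: R) j : ℝ) = arrivals R j + if e.1.1 = j then 1 else 0 := by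
  unfold arrivals
  rw [List.countP_cons]
  split_ifs <;> simp_all

lemma purchaseDev_cons (θ : Params M N) (i : Fin N) (j : Fin M) (e : Entry M N)
    (R : List (Entry M N)) : purchaseDev θ i j (e :: R) =
      purchaseDev θ i j R + ((if e.1 = (j, i, true) then 1 / e.2 i j else 0) -
        purchase θ i j * (if e.1.1 = j then 1 else 0)) := by
  simp [purchaseDev, add_comm]

lemma purchaseEst_sub_purchase (θ : Params M N) (i : Fin N) (j : Fin M) (R : List (Entry M N))
    (h : arrivals R j ≠ 0) :
    purchaseEst R i j - purchase θ i j = purchaseDev θ i j R / arrivals R j := by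
  have key : (R.map fun e : Entry M N => if e.1 = (j, i, true) then 1 / e.2 i j else 0).sum =
      purchaseDev θ i j R + purchase θ i j * arrivals R j := by
    clear h
    induction R with
    | nil => simp [purchaseDev, arrivals]
    | cons e R ih => rw [purchaseDev_cons, arrivals_cons, List.map_cons, List.sum_cons, ih]; ring
  have h' : (arrivals R j : ℝ) ≠ 0 := by exact_mod_cast h
  rw [purchaseEst, if_neg h, key]
  field_simp
  ring

/-- Exponential of the deviation of the number of arrivals. -/
def arrivalExp (θ : Params M N) (sol : List (Entry M N) → Mat M N) (l : ℝ) (j : Fin M)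
    (h : List (Obs M N)) : ℝ :=
  Real.exp (l * (arrivals (formLog sol h) j - h.length * arrival θ j) - h.length * l ^ 2)

/-- Exponential of the deviation of the purchase estimates, compensated by the arrivals. -/
def purchaseExp (θ : Params M N) (sol : List (Entry M N) → Mat M N) (e l : ℝ) (i : Fin N)
    (j : Fin M) (h : List (Obs M N)) : ℝ :=
  Real.exp (l * purchaseDev θ i j (formLog sol h) - l ^ 2 / e * arrivals (formLog sol h) j)

section Step

variable {θ : Params M N} {sol : List (Entry M N) → Mat M N}

lemma arrivalExp_step_le (hθ : θ ∈ instances M N) (hN : 0 < N)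
    (hsol : ∀ R, sol R ∈ policies M N) {l : ℝ} (hl : |l| ≤ 1) (j : Fin M)
    (h : List (Obs M N)) :
    ∑ a, stepProb θ (recAfter sol h) a * arrivalExp θ sol l j (a :: h) ≤
      arrivalExp θ sol l j h := by
  have key := sum_stepProb_exp_arrival_le hθ
    (nextRec_mem_policies hN (hsol (formLog sol h))) j hl
  calc _ = arrivalExp θ sol l j h * ∑ a : Obs M N, stepProb θ (recAfter sol h) a *
      Real.exp (l * ((if a.1 = j then 1 else 0) - arrival θ j) - l ^ 2) := by
        rw [Finset.mul_sum]
        refine Finset.sum_congr rfl fun a _ => ?_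
        rw [mul_left_comm, arrivalExp, arrivalExp, ← Real.exp_add, formLog, arrivals_cons]
        congr 2
        push_cast [List.length_cons]
        ring
    _ ≤ arrivalExp θ sol l j h := mul_le_of_le_one_right (Real.exp_pos _).le key

/-- A single `e` must serve all rounds up to the current one. This is possible because the
exploration magnitudes do not increase, so the latest one bounds all earlier offer probabilities
from below. -/
lemma purchaseExp_step_le (hθ : θ ∈ instances M N) (hN : 0 < N)
    (hsol : ∀ R, sol R ∈ policies M N) {e l : ℝ} (he : 0 < e) {h : List (Obs M N)}
    (heh : e ≤ explore N (h.length + 1)) (hl : |l| ≤ e) (i : Fin N) (j : Fin M) :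
    ∑ a, stepProb θ (recAfter sol h) a * purchaseExp θ sol e l i j (a :: h) ≤
      purchaseExp θ sol e l i j h := by
  have hex := explore_le_nextRec hN (hsol (formLog sol h)) i j
  rw [length_formLog] at hex
  have key := sum_stepProb_exp_purchase_le hθ
    (nextRec_mem_policies hN (hsol (formLog sol h))) i j he
    (heh.trans (explore_le_one hN _)) (heh.trans hex) hl
  calc _ = purchaseExp θ sol e l i j h * ∑ a : Obs M N, stepProb θ (recAfter sol h) a *
      Real.exp (l * ((if a = (j, i, true) then 1 / recAfter sol h i j else 0) -
        purchase θ i j * (if a.1 = j then 1 else 0)) -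
          l ^ 2 / e * (if a.1 = j then 1 else 0)) := by
        rw [Finset.mul_sum]
        refine Finset.sum_congr rfl fun a _ => ?_
        rw [mul_left_comm, purchaseExp, purchaseExp, ← Real.exp_add, formLog, arrivals_cons,
          purchaseDev_cons]
        congr 2
        simp only [recAfter]
        ring
    _ ≤ purchaseExp θ sol e l i j h := mul_le_of_le_one_right (Real.exp_pos _).le key

/-- Nonnegative function of the history that dominates the indicator of the event that some
estimate is inaccurate. -/
def failure (θ : Params M N) (sol : List (Entry M N) → Mat M N) (a b e l k : ℝ)
    (h : List (Obs M N)) : ℝ :=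
  a * ∑ j, (arrivalExp θ sol l j h + arrivalExp θ sol (-l) j h) +
    b * ∑ i, ∑ j, (purchaseExp θ sol e k i j h + purchaseExp θ sol e (-k) i j h)

lemma failure_nonneg {a b e l k : ℝ} (ha : 0 ≤ a) (hb : 0 ≤ b) (h : List (Obs M N)) :
    0 ≤ failure θ sol a b e l k h := by
  unfold failure arrivalExp purchaseExp
  positivity

lemma failure_nil (a b e l k : ℝ) :
    failure θ sol a b e l k [] = 2 * a * M + 2 * b * N * M := by
  simp [failure, arrivalExp, purchaseExp, purchaseDev, arrivals, formLog]
  ring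

lemma failure_step_le (hθ : θ ∈ instances M N) (hN : 0 < N)
    (hsol : ∀ R, sol R ∈ policies M N) {a b e l k : ℝ} (ha : 0 ≤ a) (hb : 0 ≤ b) (he : 0 < e)
    (hl : |l| ≤ 1) (hk : |k| ≤ e) {h : List (Obs M N)} (heh : e ≤ explore N (h.length + 1)) :
    ∑ o, stepProb θ (recAfter sol h) o * failure θ sol a b e l k (o :: h) ≤
      failure θ sol a b e l k h := by
  have h1 := fun j => arrivalExp_step_le hθ hN hsol hl j h
  have h2 := fun j => arrivalExp_step_le hθ hN hsol ((abs_neg l).trans_le hl) j h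
  have h3 := fun i j => purchaseExp_step_le hθ hN hsol he heh hk i j
  have h4 := fun i j => purchaseExp_step_le hθ hN hsol he heh ((abs_neg k).trans_le hk) i j
  have hcomm : ∑ o, stepProb θ (recAfter sol h) o * failure θ sol a b e l k (o :: h) =
      a * ∑ j, (∑ o, stepProb θ (recAfter sol h) o * arrivalExp θ sol l j (o :: h) +
        ∑ o, stepProb θ (recAfter sol h) o * arrivalExp θ sol (-l) j (o :: h)) +
      b * ∑ i, ∑ j, (∑ o, stepProb θ (recAfter sol h) o * purchaseExp θ sol e k i j (o :: h) +
        ∑ o, stepProb θ (recAfter sol h) o * purchaseExp θ sol e (-k) i j (o :: h)) := by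
    simp only [failure, mul_add, Finset.mul_sum, Finset.sum_add_distrib]
    congr 1
    · congr 1 <;> rw [Finset.sum_comm] <;>
        exact Finset.sum_congr rfl fun _ _ => Finset.sum_congr rfl fun _ _ => by ring
    · congr 1 <;> rw [Finset.sum_comm] <;>
        refine Finset.sum_congr rfl fun _ _ => ?_ <;> rw [Finset.sum_comm] <;>
        exact Finset.sum_congr rfl fun _ _ => Finset.sum_congr rfl fun _ _ => by ring
  rw [hcomm, failure]
  gcongr with j _ i _ j _
  · exact h1 j
  · exact h2 j
  · exact h3 i j
  · exact h4 i j

/-! ### Deviation bounds where the failure function is below one -/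

lemma lt_of_exp_neg_mul_exp_lt_one {a u : ℝ} (h : Real.exp (-a) * Real.exp u < 1) : u < a := by
  rw [← Real.exp_add, Real.exp_lt_one_iff] at h
  linarith

/-- All summands of `failure` are nonnegative, so each is below one and its exponent is below the
logarithm of the inverse weight. The tilts `l` and `-l` give the two sides; dividing by `l` gives
the bound. -/
lemma arrival_dev_le_of_failure_lt_one {a b e l k : ℝ} (hb : 0 ≤ b) (hl : 0 < l)
    {h : List (Obs M N)} (hf : failure θ sol (Real.exp (-a)) b e l k h < 1) (j : Fin M) :
    |(arrivals (formLog sol h) j : ℝ) - h.length * arrival θ j| ≤ a / l + h.length * l := by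
  have hA0 : ∀ l' j', 0 ≤ arrivalExp θ sol l' j' h := fun _ _ => (Real.exp_pos _).le
  have hP0 : ∀ k' i' j', 0 ≤ purchaseExp θ sol e k' i' j' h := fun _ _ _ => (Real.exp_pos _).le
  have h1 : Real.exp (-a) * (arrivalExp θ sol l j h + arrivalExp θ sol (-l) j h) < 1 := by
    refine lt_of_le_of_lt ?_ hf
    refine le_add_of_le_of_nonneg (mul_le_mul_of_nonneg_left ?_ (Real.exp_pos _).le)
      (mul_nonneg hb (Finset.sum_nonneg fun i _ => Finset.sum_nonneg fun j _ =>
        add_nonneg (hP0 _ _ _) (hP0 _ _ _)))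
    exact Finset.single_le_sum
      (f := fun j => arrivalExp θ sol l j h + arrivalExp θ sol (-l) j h)
      (fun j _ => add_nonneg (hA0 _ _) (hA0 _ _)) (Finset.mem_univ j)
  have hpos := Real.exp_pos (-a)
  have h2 : l * (arrivals (formLog sol h) j - h.length * arrival θ j) - h.length * l ^ 2 < a :=
    lt_of_exp_neg_mul_exp_lt_one (by
      refine lt_of_le_of_lt (mul_le_mul_of_nonneg_left ?_ hpos.le) h1
      exact le_add_of_nonneg_right (hA0 _ _))
  have h3 : -l * (arrivals (formLog sol h) j - h.length * arrival θ j) -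
      h.length * (-l) ^ 2 < a :=
    lt_of_exp_neg_mul_exp_lt_one (by
      refine lt_of_le_of_lt (mul_le_mul_of_nonneg_left ?_ hpos.le) h1
      exact le_add_of_nonneg_left (hA0 _ _))
  have h4 : a / l + h.length * l = (a + h.length * l ^ 2) / l := by field_simp
  rw [h4, abs_le, ← neg_div, le_div_iff₀ hl, div_le_iff₀ hl]
  constructor <;> nlinarith

lemma purchase_dev_le_of_failure_lt_one {a b e l k : ℝ} (ha : 0 ≤ a) (hk : 0 < k)
    {h : List (Obs M N)} (hf : failure θ sol a (Real.exp (-b)) e l k h < 1) (i : Fin N)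
    (j : Fin M) :
    |purchaseDev θ i j (formLog sol h)| ≤ b / k + k / e * arrivals (formLog sol h) j := by
  have hA0 : ∀ l' j', 0 ≤ arrivalExp θ sol l' j' h := fun _ _ => (Real.exp_pos _).le
  have hP0 : ∀ k' i' j', 0 ≤ purchaseExp θ sol e k' i' j' h := fun _ _ _ => (Real.exp_pos _).le
  have h1 : Real.exp (-b) * (purchaseExp θ sol e k i j h + purchaseExp θ sol e (-k) i j h) < 1 := by
    refine lt_of_le_of_lt ?_ hf
    refine le_add_of_nonneg_of_le
      (mul_nonneg ha (Finset.sum_nonneg fun j _ => add_nonneg (hA0 _ _) (hA0 _ _)))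
      (mul_le_mul_of_nonneg_left ?_ (Real.exp_pos _).le)
    refine le_trans ?_ (Finset.single_le_sum
      (f := fun i => ∑ j, (purchaseExp θ sol e k i j h + purchaseExp θ sol e (-k) i j h))
      (fun i _ => Finset.sum_nonneg fun j _ => add_nonneg (hP0 _ _ _) (hP0 _ _ _))
      (Finset.mem_univ i))
    exact Finset.single_le_sum
      (f := fun j => purchaseExp θ sol e k i j h + purchaseExp θ sol e (-k) i j h)
      (fun j _ => add_nonneg (hP0 _ _ _) (hP0 _ _ _)) (Finset.mem_univ j)
  have hpos := Real.exp_pos (-b)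
  have h2 : k * purchaseDev θ i j (formLog sol h) -
      k ^ 2 / e * arrivals (formLog sol h) j < b :=
    lt_of_exp_neg_mul_exp_lt_one (by
      refine lt_of_le_of_lt (mul_le_mul_of_nonneg_left ?_ hpos.le) h1
      exact le_add_of_nonneg_right (hP0 _ _ _))
  have h3 : -k * purchaseDev θ i j (formLog sol h) -
      (-k) ^ 2 / e * arrivals (formLog sol h) j < b :=
    lt_of_exp_neg_mul_exp_lt_one (by
      refine lt_of_le_of_lt (mul_le_mul_of_nonneg_left ?_ hpos.le) h1
      exact le_add_of_nonneg_left (hP0 _ _ _))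
  have h4 : b / k + k / e * arrivals (formLog sol h) j =
      (b + k ^ 2 / e * arrivals (formLog sol h) j) / k := by field_simp
  rw [neg_sq] at h3
  rw [h4, abs_le, ← neg_div, le_div_iff₀ hk, div_le_iff₀ hk]
  constructor <;> nlinarith

end Step

/-! ### Sensitivity of the fair recommendation problem -/

lemma abs_entry_le_norm (A : Mat M N) (i : Fin N) (j : Fin M) : |A i j| ≤ ‖A‖ :=
  (norm_le_pi_norm (A i) j).trans (norm_le_pi_norm A i)

lemma policies_le_one {x : Mat M N} (hx : x ∈ policies M N) (i : Fin N) (j : Fin M) :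
    x i j ≤ 1 := by
  have h : ∑ i, x i j = 1 := (hx j).2
  exact h ▸ Finset.single_le_sum (f := fun i => x i j) (fun i _ => (hx j).1 i) (Finset.mem_univ i)

lemma abs_sum_le_card_mul {n : ℕ} {f : Fin n → ℝ} {c : ℝ} (h : ∀ j, |f j| ≤ c) :
    |∑ j, f j| ≤ n * c := by
  refine (Finset.abs_sum_le_sum_abs _ _).trans ((Finset.sum_le_sum fun j _ => h j).trans_eq ?_)
  simp

/-- A column average of quantities bounded by `c` is bounded by `c`. -/
lemma abs_sum_mul_policies_le {x : Mat M N} (hx : x ∈ policies M N) {f : Fin N → ℝ} {c : ℝ}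
    {j : Fin M} (h : ∀ i, |f i| ≤ c) : |∑ i, f i * x i j| ≤ c := by
  have h1 : ∑ i, x i j = 1 := (hx j).2
  calc |∑ i, f i * x i j| ≤ ∑ i, |f i * x i j| := Finset.abs_sum_le_sum_abs _ _
    _ ≤ ∑ i, c * x i j := Finset.sum_le_sum fun i _ => by
        have : 0 ≤ x i j := (hx j).1 i
        rw [abs_mul, abs_of_nonneg this]
        exact mul_le_mul_of_nonneg_right (h i) this
    _ = c := by rw [← Finset.mul_sum, h1, mul_one]

/-- Each term splits as $L(x-x')+(L-L')x'$. An item collects from all $M$ types, which is where the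
factor $M$ enters; a user outcome is a column average and has no such factor. -/
lemma abs_itemOutcome_sub_le {L L' x x' : Mat M N} {a b l : ℝ}
    (hL : ∀ i j, |L i j - L' i j| ≤ a) (hx : ∀ i j, |x i j - x' i j| ≤ b)
    (hl : ∀ i j, |L i j| ≤ l) (hx' : x' ∈ policies M N) (i : Fin N) :
    |itemOutcome L x i - itemOutcome L' x' i| ≤ M * (l * b + a) := by
  rw [itemOutcome, itemOutcome, ← Finset.sum_sub_distrib]
  refine abs_sum_le_card_mul fun j => ?_
  have h0 : 0 ≤ x' i j := (hx' j).1 i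
  have h1 := policies_le_one hx' i j
  calc |L i j * x i j - L' i j * x' i j|
      = |L i j * (x i j - x' i j) + (L i j - L' i j) * x' i j| := by congr 1; ring
    _ ≤ |L i j| * |x i j - x' i j| + |L i j - L' i j| * |x' i j| := by
        rw [← abs_mul, ← abs_mul]; exact abs_add_le _ _
    _ ≤ l * b + a * 1 := by
        rw [abs_of_nonneg h0]
        have hl' := (abs_nonneg _).trans (hl i j)
        have ha' := (abs_nonneg _).trans (hL i j)
        gcongr
        · exact hl i j
        · exact hx i j
        · exact hL i j
    _ = l * b + a := by ring

lemma abs_userOutcome_sub_le {U U' x : Mat M N} {a : ℝ} (hU : ∀ i j, |U i j - U' i j| ≤ a)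
    (hx : x ∈ policies M N) (j : Fin M) :
    |userOutcome U x j - userOutcome U' x j| ≤ a := by
  rw [userOutcome, userOutcome, ← Finset.sum_sub_distrib]
  simp only [← sub_mul]
  exact abs_sum_mul_policies_le hx fun i => hU i j

lemma IsUserFair.userOutcome_eq {U f : Mat M N} (h : IsUserFair U f) (j : Fin M) :
    ∃ k, (∀ i, U i j ≤ U k j) ∧ userOutcome U f j = U k j := by
  obtain ⟨k, hk, hf⟩ := h j
  exact ⟨k, hk, by simp [userOutcome, hf]⟩

/-- The fair outcome of a user is the maximum of a column of `U`, and a maximum is 1-Lipschitz. No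
continuity of the user-fair solution is needed, and the maximizing item may jump. -/
lemma abs_userOutcome_fair_sub_le {U U' f f' : Mat M N} {a : ℝ}
    (hU : ∀ i j, |U i j - U' i j| ≤ a) (hf : IsUserFair U f) (hf' : IsUserFair U' f')
    (j : Fin M) : |userOutcome U f j - userOutcome U' f' j| ≤ a := by
  obtain ⟨k, hk, h⟩ := hf.userOutcome_eq j
  obtain ⟨k', hk', h'⟩ := hf'.userOutcome_eq j
  have h1 := abs_le.1 (hU k j)
  have h2 := abs_le.1 (hU k' j)
  rw [h, h', abs_le]
  constructor <;> linarith [hk k', hk' k]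

/-- Shifting both sides of a fairness constraint. -/
lemma constraint_shift {δ c c' v v' u w : ℝ} (hδ : δ ∈ Set.Icc (0 : ℝ) 1) (hc : |c - c'| ≤ u)
    (hv : |v - v'| ≤ w) : |(δ * c - v) - (δ * c' - v')| ≤ u + w := by
  calc |(δ * c - v) - (δ * c' - v')| = |δ * (c - c') - (v - v')| := by congr 1; ring
    _ ≤ |δ * (c - c')| + |v - v'| := abs_sub _ _
    _ ≤ u + w := by
        refine add_le_add ?_ hv
        rw [abs_mul, abs_of_nonneg hδ.1]
        nlinarith [abs_nonneg (c - c'), hδ.2]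

section Perturb

variable {S : Spec M N} {θ θ' : Params M N} {B ζ d l : ℝ}

lemma item_constraint_perturb (hθ' : θ' ∈ instances M N)
    (hLip : LocallyLipschitz S θ B ζ) (hB : 0 ≤ B) (hd : ‖θ' - θ‖ ≤ d) (hdζ : d ≤ ζ)
    (hl : ‖S.L θ‖ ≤ l) {x : Mat M N} (hx : x ∈ policies M N) (i : Fin N) :
    |(S.δI * itemOutcome (S.L θ) (S.fI θ) i - itemOutcome (S.L θ) x i) -
      (S.δI * itemOutcome (S.L θ') (S.fI θ') i - itemOutcome (S.L θ') x i)| ≤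
        M * (B * d * (2 + l)) := by
  obtain ⟨-, hL, hf⟩ := hLip θ' hθ' (hd.trans hdζ)
  have hBd : B * ‖θ - θ'‖ ≤ B * d := by rw [norm_sub_rev]; gcongr
  have hL' : ∀ i j, |S.L θ i j - S.L θ' i j| ≤ B * d := fun i j =>
    (abs_entry_le_norm (S.L θ - S.L θ') i j).trans (hL.trans hBd)
  have hf' : ∀ i j, |S.fI θ i j - S.fI θ' i j| ≤ B * d := fun i j =>
    (abs_entry_le_norm (S.fI θ - S.fI θ') i j).trans (hf.trans hBd)
  have hl' : ∀ i j, |S.L θ i j| ≤ l := fun i j => (abs_entry_le_norm _ i j).trans hl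
  -- The fair outcome changes through both the matrix and the fair solution, by $M(l+1)Bd$; the
  -- outcome of the fixed `x` changes only through the matrix, by $MBd$.
  refine (constraint_shift S.δI_mem
    (abs_itemOutcome_sub_le hL' hf' hl' (S.itemFair θ' hθ').1 i)
    (abs_itemOutcome_sub_le hL' (b := 0) (by simp) hl' hx i)).trans_eq ?_
  ring

lemma user_constraint_perturb (hθ : θ ∈ instances M N) (hθ' : θ' ∈ instances M N)
    (hLip : LocallyLipschitz S θ B ζ) (hB : 0 ≤ B) (hd : ‖θ' - θ‖ ≤ d) (hdζ : d ≤ ζ)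
    {x : Mat M N} (hx : x ∈ policies M N) (j : Fin M) :
    |(S.δU * userOutcome (S.U θ) (S.fU θ) j - userOutcome (S.U θ) x j) -
      (S.δU * userOutcome (S.U θ') (S.fU θ') j - userOutcome (S.U θ') x j)| ≤ 2 * (B * d) := by
  obtain ⟨hU, -, -⟩ := hLip θ' hθ' (hd.trans hdζ)
  have hBd : B * ‖θ - θ'‖ ≤ B * d := by rw [norm_sub_rev]; gcongr
  have hU' : ∀ i j, |S.U θ i j - S.U θ' i j| ≤ B * d := fun i j =>
    (abs_entry_le_norm (S.U θ - S.U θ') i j).trans (hU.trans hBd)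
  refine (constraint_shift S.δU_mem
    (abs_userOutcome_fair_sub_le hU' (S.userFair θ hθ) (S.userFair θ' hθ') j)
    (abs_userOutcome_sub_le hU' hx j)).trans_eq ?_
  ring

lemma abs_arrival_sub_le (θ θ' : Params M N) (j : Fin M) :
    |arrival θ j - arrival θ' j| ≤ ‖θ - θ'‖ :=
  (norm_le_pi_norm (θ.1 - θ'.1) j).trans (norm_fst_le (θ - θ'))

lemma abs_purchase_sub_le (θ θ' : Params M N) (i : Fin N) (j : Fin M) :
    |purchase θ i j - purchase θ' i j| ≤ ‖θ - θ'‖ :=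
  (abs_entry_le_norm (θ.2.1 - θ'.2.1) i j).trans
    ((norm_fst_le (θ - θ').2).trans (norm_snd_le (θ - θ')))

lemma rev_eq_sum_users (x : Mat M N) (θ : Params M N) :
    rev x θ = ∑ j, arrival θ j * ∑ i, (revenue θ i * purchase θ i j) * x i j := by
  rw [rev, Finset.sum_comm]
  refine Finset.sum_congr rfl fun j _ => ?_
  rw [Finset.mul_sum]
  exact Finset.sum_congr rfl fun i _ => by ring

lemma abs_sum_arrival_mul_le (hθ : θ ∈ instances M N) {f : Fin M → ℝ} {c : ℝ}
    (h : ∀ j, |f j| ≤ c) : |∑ j, arrival θ j * f j| ≤ c := by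
  have h0 : ∀ j, 0 ≤ arrival θ j := hθ.1.1
  have h1 : ∑ j, arrival θ j = 1 := hθ.1.2
  calc |∑ j, arrival θ j * f j| ≤ ∑ j, |arrival θ j * f j| := Finset.abs_sum_le_sum_abs _ _
    _ ≤ ∑ j, arrival θ j * c := Finset.sum_le_sum fun j _ => by
        rw [abs_mul, abs_of_nonneg (h0 j)]
        exact mul_le_mul_of_nonneg_left (h j) (h0 j)
    _ = c := by rw [← Finset.sum_mul, h1, one_mul]

lemma abs_revenue_mul_purchase_le (hθ : θ ∈ instances M N) {r : ℝ} (hr : ‖revenue θ‖ ≤ r)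
    (i : Fin N) (j : Fin M) : |revenue θ i * purchase θ i j| ≤ r := by
  have h1 : |revenue θ i| ≤ r := (norm_le_pi_norm (revenue θ) i).trans hr
  have h2 := hθ.2 i j
  rw [abs_mul, abs_of_pos h2.1]
  nlinarith [abs_nonneg (revenue θ i), h2.2]

lemma abs_rev_le (hθ : θ ∈ instances M N) {r : ℝ} (hr : ‖revenue θ‖ ≤ r) {x : Mat M N}
    (hx : x ∈ policies M N) : |rev x θ| ≤ r := by
  rw [rev_eq_sum_users]
  exact abs_sum_arrival_mul_le hθ fun j =>
    abs_sum_mul_policies_le hx fun i => abs_revenue_mul_purchase_le hθ hr i j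

/-- Changing $p$ costs $d\,r$ for each of the $M$ types; changing $y$ is averaged against the
probability vector $p$ and costs $d\,r$ once. -/
lemma abs_rev_sub_rev_le (hθ : θ ∈ instances M N) (hθ' : θ' ∈ instances M N)
    (hrev : revenue θ' = revenue θ) {r : ℝ} (hr : ‖revenue θ‖ ≤ r) (hd : ‖θ' - θ‖ ≤ d)
    {x : Mat M N} (hx : x ∈ policies M N) : |rev x θ' - rev x θ| ≤ r * d * (M + 1) := by
  rw [rev_eq_sum_users, rev_eq_sum_users, ← Finset.sum_sub_distrib]
  have hr0 : 0 ≤ r := (norm_nonneg _).trans hr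
  have hd0 : 0 ≤ d := (norm_nonneg _).trans hd
  have hsplit : ∀ j, arrival θ' j * ∑ i, (revenue θ' i * purchase θ' i j) * x i j -
      arrival θ j * ∑ i, (revenue θ i * purchase θ i j) * x i j =
      (arrival θ' j - arrival θ j) * (∑ i, (revenue θ' i * purchase θ' i j) * x i j) +
      arrival θ j * ∑ i, (revenue θ i * (purchase θ' i j - purchase θ i j)) * x i j := by
    intro j
    have : ∑ i, (revenue θ i * (purchase θ' i j - purchase θ i j)) * x i j =
        (∑ i, (revenue θ' i * purchase θ' i j) * x i j) -
          ∑ i, (revenue θ i * purchase θ i j) * x i j := by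
      rw [← Finset.sum_sub_distrib]
      exact Finset.sum_congr rfl fun i _ => by rw [hrev]; ring
    rw [this]; ring
  simp only [hsplit]
  rw [Finset.sum_add_distrib]
  have h1 : |∑ j, (arrival θ' j - arrival θ j) *
      (∑ i, (revenue θ' i * purchase θ' i j) * x i j)| ≤ M * (d * r) := by
    refine abs_sum_le_card_mul fun j => ?_
    rw [abs_mul]
    refine mul_le_mul ((abs_arrival_sub_le θ' θ j).trans hd) ?_ (abs_nonneg _) hd0
    exact abs_sum_mul_policies_le hx fun i =>
      abs_revenue_mul_purchase_le hθ' (hrev ▸ hr) i j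
  have h2 : |∑ j, arrival θ j *
      ∑ i, (revenue θ i * (purchase θ' i j - purchase θ i j)) * x i j| ≤ r * d := by
    refine abs_sum_arrival_mul_le hθ fun j => abs_sum_mul_policies_le hx fun i => ?_
    rw [abs_mul]
    refine mul_le_mul ((norm_le_pi_norm (revenue θ) i).trans hr)
      ((abs_purchase_sub_le θ' θ i j).trans hd) (abs_nonneg _) hr0
  refine (abs_add_le _ _).trans ((add_le_add h1 h2).trans_eq ?_)
  ring

/-- Makes the optimal solution of the true problem a competitor in the relaxed problem that the
algorithm solves. -/
lemma Feasible.perturb (hθ : θ ∈ instances M N) (hθ' : θ' ∈ instances M N)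
    (hLip : LocallyLipschitz S θ B ζ) (hB : 0 ≤ B) (hd : ‖θ' - θ‖ ≤ d) (hdζ : d ≤ ζ)
    (hl : ‖S.L θ‖ ≤ l) {η : ℝ} (hη : M * (B * d * (2 + l)) ≤ η) (hη' : 2 * (B * d) ≤ η)
    {x : Mat M N} (hx : Feasible S θ 0 x) : Feasible S θ' η x := by
  refine ⟨hx.1, fun i => ?_, fun j => ?_⟩
  · have h1 := (abs_le.1 (item_constraint_perturb hθ' hLip hB hd hdζ hl hx.1 i)).1
    have h2 := hx.2.1 i
    linarith
  · have h1 := (abs_le.1 (user_constraint_perturb hθ hθ' hLip hB hd hdζ hx.1 j)).1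
    have h2 := hx.2.2 j
    linarith

end Perturb

/-! ### Cost of exploration -/

lemma abs_sum_mul_explore_le {n : ℕ} {f w : Fin n → ℝ} {ε c : ℝ} (hε : 0 ≤ ε) (hc : 0 ≤ c)
    (hf : ∀ i, |f i| ≤ c) (hw : w ∈ stdSimplex ℝ (Fin n)) :
    |∑ i, f i * ((1 - n * ε) * w i + ε) - ∑ i, f i * w i| ≤ 2 * c * (n * ε) := by
  have h1 : ∑ i, w i = 1 := hw.2
  rw [← Finset.sum_sub_distrib]
  refine (Finset.abs_sum_le_sum_abs _ _).trans ?_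
  calc ∑ i, |f i * ((1 - n * ε) * w i + ε) - f i * w i|
      ≤ ∑ i, (c * (n * ε) * w i + c * ε) := by
        refine Finset.sum_le_sum fun i _ => ?_
        have h0 : 0 ≤ w i := hw.1 i
        rw [show f i * ((1 - n * ε) * w i + ε) - f i * w i = f i * (ε - n * ε * w i) by ring,
          abs_mul, show c * (n * ε) * w i + c * ε = c * (n * ε * w i + ε) by ring]
        refine mul_le_mul (hf i) (abs_le.2 ?_) (abs_nonneg _) hc
        have : 0 ≤ n * ε * w i := by positivity
        constructor <;> linarith
    _ = 2 * c * (n * ε) := by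
        rw [Finset.sum_add_distrib, ← Finset.mul_sum, h1]
        simp
        ring

/-! ### Confidence radii -/

/-- The rate `N^{1/3} t^{-1/3} (log T)^{3/2}` at round `t + 1`. -/
def rate (N T t : ℕ) : ℝ :=
  (N : ℝ) ^ (1 / 3 : ℝ) * ((t : ℝ) + 1) ^ (-(1 / 3) : ℝ) * Real.log T ^ (3 / 2 : ℝ)

lemma rate_nonneg (N T t : ℕ) : 0 ≤ rate N T t := by
  unfold rate
  have : 0 ≤ Real.log T := Real.log_natCast_nonneg T
  positivity

lemma rate_ge {T : ℕ} (hL : 1 ≤ Real.log T) (t : ℕ) :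
    (N : ℝ) ^ (1 / 3 : ℝ) * ((t : ℝ) + 1) ^ (-(1 / 3) : ℝ) ≤ rate N T t :=
  le_mul_of_one_le_right (by positivity) (Real.one_le_rpow hL (by norm_num))

lemma rate_cube (N T t : ℕ) :
    rate N T t ^ 3 = N * Real.log T ^ (9 / 2 : ℝ) / ((t : ℝ) + 1) := by
  have hL : 0 ≤ Real.log T := Real.log_natCast_nonneg T
  have hn : (0 : ℝ) < (t : ℝ) + 1 := by positivity
  rw [rate, mul_pow, mul_pow, ← Real.rpow_mul_natCast (by positivity),
    ← Real.rpow_mul_natCast hn.le, ← Real.rpow_mul_natCast hL]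
  norm_num
  rw [Real.rpow_neg_one]
  ring

lemma mul_explore_le_rate (hN : 0 < N) {T : ℕ} (hL : 1 ≤ Real.log T) (t : ℕ) :
    N * explore N (t + 1) ≤ rate N T t := by
  refine le_trans ?_ (rate_ge hL t)
  have hN' : (0 : ℝ) < N := by exact_mod_cast hN
  calc N * explore N (t + 1)
      ≤ N * ((N : ℝ) ^ (-(2 / 3) : ℝ) * ((t + 1 : ℕ) : ℝ) ^ (-(1 / 3) : ℝ)) := by
        gcongr; exact min_le_right _ _
    _ = (N : ℝ) ^ (1 / 3 : ℝ) * ((t : ℝ) + 1) ^ (-(1 / 3) : ℝ) := by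
        push_cast
        rw [← mul_assoc]
        congr 1
        rw [show (1 / 3 : ℝ) = 1 + -(2 / 3) by norm_num, Real.rpow_add hN', Real.rpow_one]

/-- The cube of the rate is $N(\log T)^{9/2}/(t+1)$, and the logarithm is at least one. -/
lemma le_of_rate_lt_one (hN : 0 < N) {T t : ℕ} (hL : 1 ≤ Real.log T) (h : rate N T t < 1) :
    (N : ℝ) ≤ (t : ℝ) + 1 := by
  have h0 := rate_nonneg N T t
  have h1 : rate N T t ^ 3 < 1 := pow_lt_one₀ h0 h (by norm_num)
  have hn : (0 : ℝ) < (t : ℝ) + 1 := by positivity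
  have hN' : (0 : ℝ) < N := by exact_mod_cast hN
  rw [rate_cube, div_lt_one hn] at h1
  have : 1 ≤ Real.log T ^ (9 / 2 : ℝ) := Real.one_le_rpow hL (by norm_num)
  nlinarith

lemma log_cube_le_of_rate_le (hN : 0 < N) {T t : ℕ} (hL : 1 ≤ Real.log T)
    (h : rate N T t ≤ 1 / 3) : 27 * Real.log T ^ 3 ≤ (t : ℝ) + 1 := by
  have h0 := rate_nonneg N T t
  have h1 : rate N T t ^ 3 ≤ (1 / 3) ^ 3 := by gcongr
  have hn : (0 : ℝ) < (t : ℝ) + 1 := by positivity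
  have hN' : (1 : ℝ) ≤ N := by exact_mod_cast hN
  rw [rate_cube, div_le_iff₀ hn] at h1
  have h2 : Real.log T ^ 3 ≤ Real.log T ^ (9 / 2 : ℝ) := by
    rw [← Real.rpow_natCast]
    exact Real.rpow_le_rpow_of_exponent_le hL (by norm_num)
  have h3 : 0 ≤ Real.log T ^ 3 := by positivity
  nlinarith

/-- In the regime of a small rate, exploration is at its default magnitude. -/
lemma rate_sq_mul_explore (hN : 0 < N) {T t : ℕ} (hL : 1 ≤ Real.log T) (h : rate N T t < 1) :
    rate N T t ^ 2 * explore N (t + 1) * ((t : ℝ) + 1) = Real.log T ^ 3 := by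
  have hle := le_of_rate_lt_one hN hL h
  have hN' : (0 : ℝ) < N := by exact_mod_cast hN
  have hn : (0 : ℝ) < (t : ℝ) + 1 := by positivity
  have hε : explore N (t + 1) = (N : ℝ) ^ (-(2 / 3) : ℝ) * ((t : ℝ) + 1) ^ (-(1 / 3) : ℝ) := by
    rw [explore]
    push_cast
    refine min_eq_right ?_
    calc (N : ℝ) ^ (-(2 / 3) : ℝ) * ((t : ℝ) + 1) ^ (-(1 / 3) : ℝ)
        ≤ (N : ℝ) ^ (-(2 / 3) : ℝ) * (N : ℝ) ^ (-(1 / 3) : ℝ) := by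
          gcongr ?_ * ?_
          exact Real.rpow_le_rpow_of_nonpos hN' hle (by norm_num)
      _ = (N : ℝ)⁻¹ := by rw [← Real.rpow_add hN', ← Real.rpow_neg_one]; norm_num
  have hL0 : 0 ≤ Real.log T := by linarith
  rw [hε, rate, mul_pow, mul_pow, ← Real.rpow_mul_natCast (by positivity),
    ← Real.rpow_mul_natCast hn.le, ← Real.rpow_mul_natCast hL0]
  have e1 : (N : ℝ) ^ (1 / 3 * (2 : ℕ) : ℝ) * (N : ℝ) ^ (-(2 / 3) : ℝ) = 1 := by
    rw [← Real.rpow_add hN']; norm_num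
  have e2 : ((t : ℝ) + 1) ^ (-(1 / 3) * (2 : ℕ) : ℝ) * ((t : ℝ) + 1) ^ (-(1 / 3) : ℝ) *
      ((t : ℝ) + 1) = 1 := by
    rw [← Real.rpow_add hn]
    nth_rewrite 2 [← Real.rpow_one ((t : ℝ) + 1)]
    rw [← Real.rpow_add hn]; norm_num
  have e3 : Real.log T ^ (3 / 2 * (2 : ℕ) : ℝ) = Real.log T ^ 3 := by
    rw [← Real.rpow_natCast]; norm_num
  rw [e3]
  linear_combination (Real.log T ^ 3 * (((t : ℝ) + 1) ^ (-(1 / 3) * (2 : ℕ) : ℝ) *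
    ((t : ℝ) + 1) ^ (-(1 / 3) : ℝ) * ((t : ℝ) + 1))) * e1 + Real.log T ^ 3 * e2

/-- Guaranteed number of arrivals of each type among the first `t` users. -/
def minArrivals (T t : ℕ) : ℝ := t / (2 * Real.log T)

/-- Accuracy of the estimated purchase probabilities after `t` users. -/
def purchaseAcc (N T t : ℕ) : ℝ :=
  2 * Real.log T / √(explore N (t + 1) * minArrivals T t)

/-- Accuracy of the estimated arrival probabilities after `t` users. -/
def arrivalAcc (T t : ℕ) : ℝ := 2 * √(Real.log T / t)

section Radii

variable {T t : ℕ}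

lemma time_ge_of_rate_le (hN : 0 < N) (hL : 1 ≤ Real.log T) (h : rate N T t ≤ 1 / 3) :
    16 * Real.log T ^ 3 ≤ (t : ℝ) := by
  have h1 := log_cube_le_of_rate_le hN hL h
  have h2 : 1 ≤ Real.log T ^ 3 := one_le_pow₀ hL
  linarith

/-- A rearrangement of `rate_sq_mul_explore` with $t+1\le2t$. It serves twice: it bounds the
purchase accuracy by the rate, and it makes the tilt of the purchase supermartingale admissible. -/
lemma log_sq_le_rate_sq (hN : 0 < N) (hL : 1 ≤ Real.log T) (h : rate N T t ≤ 1 / 3) :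
    Real.log T ^ 2 ≤ 4 * rate N T t ^ 2 * (explore N (t + 1) * minArrivals T t) := by
  have h1 := rate_sq_mul_explore hN hL (h.trans_lt (by norm_num))
  have ht := time_ge_of_rate_le hN hL h
  have h2 : 1 ≤ Real.log T ^ 3 := one_le_pow₀ hL
  have hL0 : 0 < Real.log T := by linarith
  have hq : 0 ≤ rate N T t ^ 2 * explore N (t + 1) := by
    have := explore_pos hN t
    positivity
  have h3 : Real.log T ^ 3 ≤ rate N T t ^ 2 * explore N (t + 1) * (2 * t) := by
    rw [← h1]; exact mul_le_mul_of_nonneg_left (by linarith) hq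
  rw [minArrivals, show 4 * rate N T t ^ 2 * (explore N (t + 1) * (t / (2 * Real.log T))) =
    (rate N T t ^ 2 * explore N (t + 1) * (2 * t)) / Real.log T by field_simp; ring,
    le_div_iff₀ hL0]
  linarith

lemma minArrivals_pos (hL : 1 ≤ Real.log T) (ht : 0 < t) : 0 < minArrivals T t := by
  unfold minArrivals
  have : (0 : ℝ) < t := by exact_mod_cast ht
  positivity

lemma time_pos_of_rate_le (hN : 0 < N) (hL : 1 ≤ Real.log T) (h : rate N T t ≤ 1 / 3) :
    0 < t := by
  have ht := time_ge_of_rate_le hN hL h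
  have h2 : 1 ≤ Real.log T ^ 3 := one_le_pow₀ hL
  have : (0 : ℝ) < t := by linarith
  exact_mod_cast this

lemma purchaseAcc_le_rate (hN : 0 < N) (hL : 1 ≤ Real.log T) (h : rate N T t ≤ 1 / 3) :
    purchaseAcc N T t ≤ 4 * rate N T t := by
  have h1 := log_sq_le_rate_sq hN hL h
  have hm := minArrivals_pos hL (time_pos_of_rate_le hN hL h)
  have hε := explore_pos hN t
  have hr := rate_nonneg N T t
  rw [purchaseAcc, div_le_iff₀ (by positivity)]
  have h2 : Real.log T ≤ 2 * rate N T t * √(explore N (t + 1) * minArrivals T t) := by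
    refine le_of_sq_le_sq ?_ (by positivity)
    rw [mul_pow, Real.sq_sqrt (by positivity)]
    linarith
  linarith

/-- The maximum in the radius is at most $2t/\log T$, four times the guaranteed number of arrivals;
the square root turns four into two. -/
lemma purchaseAcc_le_radiusY (hN : 0 < N) (hL : 1 ≤ Real.log T) (h : rate N T t ≤ 1 / 3) :
    purchaseAcc N T t ≤ 2 * radiusY N T (t + 1) := by
  have ht := time_ge_of_rate_le hN hL h
  have hm := minArrivals_pos hL (time_pos_of_rate_le hN hL h)
  have hε := explore_pos hN t
  have hL3 : Real.log T ≤ Real.log T ^ 3 := le_self_pow₀ hL (by norm_num)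
  have hmax : max 1 (((t + 1 : ℕ) : ℝ) / Real.log T - √(((t + 1 : ℕ) : ℝ) * Real.log T / 2)) ≤
      4 * minArrivals T t := by
    have hL0 : 0 < Real.log T := by linarith
    have e : 4 * minArrivals T t = 2 * t / Real.log T := by
      unfold minArrivals; field_simp; ring
    rw [e]
    refine max_le ((one_le_div hL0).2 (by linarith)) ?_
    have h0 := Real.sqrt_nonneg (((t + 1 : ℕ) : ℝ) * Real.log T / 2)
    have h3 : ((t + 1 : ℕ) : ℝ) / Real.log T ≤ 2 * t / Real.log T := by
      gcongr
      push_cast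
      linarith
    linarith
  have hs : √(explore N (t + 1) * max 1 (((t + 1 : ℕ) : ℝ) / Real.log T -
      √(((t + 1 : ℕ) : ℝ) * Real.log T / 2))) ≤ 2 * √(explore N (t + 1) * minArrivals T t) := by
    rw [← Real.sqrt_sq (by norm_num : (0 : ℝ) ≤ 2), ← Real.sqrt_mul (by norm_num),
      Real.sqrt_sq (by norm_num : (0 : ℝ) ≤ 2)]
    refine Real.sqrt_le_sqrt ?_
    rw [mul_left_comm]
    exact mul_le_mul_of_nonneg_left (hmax.trans_eq (by norm_num)) hε.le
  have hmax1 : (0 : ℝ) < max 1 (((t + 1 : ℕ) : ℝ) / Real.log T -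
      √(((t + 1 : ℕ) : ℝ) * Real.log T / 2)) := lt_of_lt_of_le one_pos (le_max_left _ _)
  rw [purchaseAcc, radiusY, mul_div_assoc', div_le_div_iff₀ (by positivity) (by positivity)]
  nlinarith

/-- For $t+1\ge2(\log T)^3$ the subtracted root is at most half of $(t+1)/\log T$, so the other half
remains and dominates the guaranteed number of arrivals. -/
lemma radiusY_le_purchaseAcc (hN : 0 < N) (hL : 1 ≤ Real.log T) (h : rate N T t ≤ 1 / 3) :
    radiusY N T (t + 1) ≤ purchaseAcc N T t := by
  have ht := time_ge_of_rate_le hN hL h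
  have hm := minArrivals_pos hL (time_pos_of_rate_le hN hL h)
  have hε := explore_pos hN t
  have hL0 : 0 < Real.log T := by linarith
  unfold radiusY purchaseAcc
  gcongr
  refine le_trans ?_ (le_max_right _ _)
  have hsq : √(((t + 1 : ℕ) : ℝ) * Real.log T / 2) ≤ ((t + 1 : ℕ) : ℝ) / (2 * Real.log T) := by
    refine Real.sqrt_le_iff.2 ⟨by positivity, ?_⟩
    rw [div_pow, div_le_div_iff₀ (by norm_num) (by positivity)]
    push_cast
    have h3 : 2 * Real.log T ^ 3 ≤ (t : ℝ) + 1 := by nlinarith [pow_pos hL0 3]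
    nlinarith [mul_le_mul_of_nonneg_left h3 (by positivity : (0 : ℝ) ≤ 2 * ((t : ℝ) + 1))]
  have e : ((t + 1 : ℕ) : ℝ) / Real.log T = 2 * (((t + 1 : ℕ) : ℝ) / (2 * Real.log T)) := by
    field_simp
  have e2 : minArrivals T t ≤ ((t + 1 : ℕ) : ℝ) / (2 * Real.log T) := by
    unfold minArrivals; gcongr; simp
  linarith

lemma log_le_rate_sq (hN : 0 < N) (hL : 1 ≤ Real.log T) (h : rate N T t ≤ 1 / 3) :
    Real.log T ≤ rate N T t ^ 2 * ((t : ℝ) + 1) := by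
  have h1 := rate_sq_mul_explore hN hL (h.trans_lt (by norm_num))
  have h2 := explore_le_one hN t
  have h3 : Real.log T ≤ Real.log T ^ 3 := le_self_pow₀ hL (by norm_num)
  have h4 : 0 ≤ rate N T t ^ 2 * ((t : ℝ) + 1) := by positivity
  nlinarith

lemma arrivalAcc_le_rate (hN : 0 < N) (hL : 1 ≤ Real.log T) (h : rate N T t ≤ 1 / 3) :
    arrivalAcc T t ≤ 4 * rate N T t := by
  have h1 := log_le_rate_sq hN hL h
  have ht0 : (1 : ℝ) ≤ t := by exact_mod_cast time_pos_of_rate_le hN hL h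
  have hr := rate_nonneg N T t
  have h2 : √(Real.log T / t) ≤ 2 * rate N T t := by
    refine Real.sqrt_le_iff.2 ⟨by positivity, ?_⟩
    rw [div_le_iff₀ (by positivity)]
    nlinarith [sq_nonneg (rate N T t)]
  unfold arrivalAcc
  linarith

lemma log_three_mul (hL : 1 ≤ Real.log T) :
    Real.log (3 * T) = Real.log 3 + Real.log T := by
  have : (T : ℝ) ≠ 0 := by rintro h; rw [h] at hL; norm_num at hL
  exact Real.log_mul (by norm_num) this

lemma arrivalAcc_le_radiusP (hL : 1 ≤ Real.log T) (ht : 0 < t) :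
    arrivalAcc T t ≤ radiusP T (t + 1) := by
  have ht0 : (1 : ℝ) ≤ t := by exact_mod_cast ht
  have h3 : 0 ≤ Real.log 3 := Real.log_nonneg (by norm_num)
  unfold arrivalAcc radiusP
  rw [log_three_mul hL]
  have h2 : √(Real.log T / t) ≤ 2 * √((Real.log 3 + Real.log T) / ((t + 1 : ℕ) : ℝ)) := by
    rw [show (2 : ℝ) = √4 by rw [show (4 : ℝ) = 2 ^ 2 by norm_num]; simp,
      ← Real.sqrt_mul (by norm_num)]
    refine Real.sqrt_le_sqrt ?_
    rw [mul_div_assoc', div_le_div_iff₀ (by positivity) (by positivity)]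
    push_cast
    nlinarith
  have := Real.sqrt_nonneg ((Real.log 3 + Real.log T) / ((t + 1 : ℕ) : ℝ))
  linarith

lemma radiusP_le_rate (hN : 0 < N) (hL : 2 ≤ Real.log T) (h : rate N T t ≤ 1 / 3) :
    radiusP T (t + 1) ≤ 8 * rate N T t := by
  have h1 := log_le_rate_sq hN (by linarith) h
  have hr := rate_nonneg N T t
  have h3 : Real.log 3 ≤ 2 := (Real.log_le_sub_one_of_pos (by norm_num)).trans (by norm_num)
  -- Since $\log3\le2\le\log T$, the numerator is at most $2\log T$, and $2\le(8/5)^2$.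
  have h2 : √(Real.log (3 * T) / ((t + 1 : ℕ) : ℝ)) ≤ 8 / 5 * rate N T t := by
    refine Real.sqrt_le_iff.2 ⟨by positivity, ?_⟩
    rw [div_le_iff₀ (by positivity), log_three_mul (by linarith)]
    push_cast
    nlinarith [sq_nonneg (rate N T t)]
  unfold radiusP
  linarith

end Radii

/-! ### Accuracy of the estimates -/

lemma sum_arrivals (R : List (Entry M N)) : ∑ j, (arrivals R j : ℝ) = R.length := by
  induction R with
  | nil => simp [arrivals]
  | cons e R ih => simp [arrivals_cons, Finset.sum_add_distrib, ih]

lemma arrivalEst_mem_stdSimplex {R : List (Entry M N)} (hR : R.length ≠ 0) :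
    arrivalEst R ∈ stdSimplex ℝ (Fin M) := by
  have h : (R.length : ℝ) ≠ 0 := by exact_mod_cast hR
  refine ⟨fun j => ?_, ?_⟩
  · rw [arrivalEst, if_neg hR]; positivity
  · simp only [arrivalEst, if_neg hR]
    rw [← Finset.sum_div, sum_arrivals, div_self h]

/-- The failure function for a horizon `T`, as used in round `t + 1`. -/
def failureAt (θ : Params M N) (sol : List (Entry M N) → Mat M N) (T t : ℕ)
    (h : List (Obs M N)) : ℝ :=
  failure θ sol (Real.exp (-Real.log T)) (Real.exp (-Real.log T ^ 2)) (explore N (t + 1))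
    √(Real.log T / t) (Real.log T * √(explore N (t + 1) / minArrivals T t)) h

section Accuracy

variable {θ : Params M N} {sol : List (Entry M N) → Mat M N} {T t : ℕ} {h : List (Obs M N)}

lemma arrivals_dev_of_failureAt (hL : 1 ≤ Real.log T) (ht : 0 < t) (hlen : h.length = t)
    (hf : failureAt θ sol T t h < 1) (j : Fin M) :
    |(arrivals (formLog sol h) j : ℝ) - t * arrival θ j| ≤ t * arrivalAcc T t := by
  have ht0 : (0 : ℝ) < t := by exact_mod_cast ht
  have hs : 0 < √(Real.log T / t) := by positivity
  have key := arrival_dev_le_of_failure_lt_one (Real.exp_pos _).le hs hf j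
  rw [hlen] at key
  refine key.trans_eq ?_
  -- The tilt $\sqrt{\log T/t}$ balances the two terms of the deviation bound.
  have e : Real.log T / √(Real.log T / t) = t * √(Real.log T / t) := by
    rw [div_eq_iff hs.ne', mul_assoc, Real.mul_self_sqrt (by positivity)]
    field_simp
  rw [e, arrivalAcc]
  ring

/-- The expected count is at least $t/\log T$, and for $t\ge16(\log T)^3$ the deviation is at most
half of that. -/
lemma minArrivals_le_arrivals (hN : 0 < N) (hL : 1 ≤ Real.log T) (hr : rate N T t ≤ 1 / 3)
    (hlen : h.length = t) (hf : failureAt θ sol T t h < 1) {j : Fin M}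
    (hp : 1 / Real.log T ≤ arrival θ j) :
    minArrivals T t ≤ arrivals (formLog sol h) j := by
  have ht := time_pos_of_rate_le hN hL hr
  have ht0 : (0 : ℝ) < t := by exact_mod_cast ht
  have ht16 := time_ge_of_rate_le hN hL hr
  have h1 := (abs_le.1 (arrivals_dev_of_failureAt hL ht hlen hf j)).1
  have hL0 : 0 < Real.log T := by linarith
  have h2 : √(Real.log T / t) ≤ 1 / (4 * Real.log T) := by
    refine Real.sqrt_le_iff.2 ⟨by positivity, ?_⟩
    rw [div_pow, div_le_div_iff₀ (by positivity) (by positivity)]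
    nlinarith
  have h3 : t * arrivalAcc T t ≤ t * (1 / (2 * Real.log T)) := by
    gcongr
    rw [arrivalAcc, show 1 / (2 * Real.log T) = 2 * (1 / (4 * Real.log T)) by field_simp; norm_num]
    linarith
  have h4 : t * (1 / Real.log T) ≤ t * arrival θ j := by gcongr
  have e : minArrivals T t = t * (1 / Real.log T) - t * (1 / (2 * Real.log T)) := by
    unfold minArrivals; field_simp; ring
  linarith

lemma abs_arrivalEst_sub_le (hL : 1 ≤ Real.log T) (ht : 0 < t) (hlen : h.length = t)
    (hf : failureAt θ sol T t h < 1) (j : Fin M) :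
    |arrivalEst (formLog sol h) j - arrival θ j| ≤ arrivalAcc T t := by
  have ht0 : (0 : ℝ) < t := by exact_mod_cast ht
  have key := arrivals_dev_of_failureAt hL ht hlen hf j
  rw [arrivalEst, length_formLog, hlen, if_neg ht.ne',
    show (arrivals (formLog sol h) j : ℝ) / t - arrival θ j =
      (arrivals (formLog sol h) j - t * arrival θ j) / t by field_simp,
    abs_div, abs_of_pos ht0, div_le_iff₀ ht0]
  linarith

lemma abs_purchaseEst_sub_le (hN : 0 < N) (hL : 1 ≤ Real.log T) (hr : rate N T t ≤ 1 / 3)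
    (hlen : h.length = t) (hf : failureAt θ sol T t h < 1) (i : Fin N) {j : Fin M}
    (hp : 1 / Real.log T ≤ arrival θ j) :
    |purchaseEst (formLog sol h) i j - purchase θ i j| ≤ purchaseAcc N T t := by
  have ht := time_pos_of_rate_le hN hL hr
  have hm := minArrivals_pos hL ht
  have hε := explore_pos hN t
  have hL0 : 0 < Real.log T := by linarith
  have hn := minArrivals_le_arrivals hN hL hr hlen hf hp
  have hn0 : (0 : ℝ) < arrivals (formLog sol h) j := hm.trans_le hn
  have key := purchase_dev_le_of_failure_lt_one (Real.exp_pos _).le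
    (mul_pos hL0 (Real.sqrt_pos.2 (div_pos hε hm))) hf i j
  rw [purchaseEst_sub_purchase θ i j _ (by exact_mod_cast hn0.ne'), abs_div, abs_of_pos hn0,
    div_le_iff₀ hn0]
  refine key.trans ?_
  set ε := explore N (t + 1)
  set m := minArrivals T t
  set n := ((arrivals (formLog sol h) j : ℕ) : ℝ)
  have hsε : 0 < √ε := Real.sqrt_pos.2 hε
  have hsm : 0 < √m := Real.sqrt_pos.2 hm
  -- The tilt is optimal for exactly $m$ arrivals. As the actual count is at least $m$, the first
  -- term is also bounded by its multiple of the count.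
  have e1 : Real.log T ^ 2 / (Real.log T * √(ε / m)) = Real.log T / √(ε * m) * m := by
    rw [Real.sqrt_div hε.le, Real.sqrt_mul hε.le]
    field_simp
    rw [Real.sq_sqrt hm.le]
  have e2 : Real.log T * √(ε / m) / ε = Real.log T / √(ε * m) := by
    rw [Real.sqrt_div hε.le, Real.sqrt_mul hε.le]
    field_simp
    rw [Real.sq_sqrt hε.le]
  rw [e1, e2]
  have h0 : 0 ≤ Real.log T / √(ε * m) := by positivity
  have h1 := mul_le_mul_of_nonneg_left hn h0
  calc Real.log T / √(ε * m) * m + Real.log T / √(ε * m) * n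
      ≤ 2 * (Real.log T / √(ε * m)) * n := by linarith
    _ = purchaseAcc N T t * n := by rw [purchaseAcc, mul_div_assoc]

/-- Accuracy of the estimated instance after `t` users. -/
lemma norm_estimate_sub_le (hN : 0 < N) (hL : 1 ≤ Real.log T) (hr : rate N T t ≤ 1 / 3)
    (hlen : h.length = t) (hf : failureAt θ sol T t h < 1)
    (hp : ∀ j, 1 / Real.log T ≤ arrival θ j) :
    ‖estimate (revenue θ) (formLog sol h) - θ‖ ≤ max (purchaseAcc N T t) (arrivalAcc T t) := by
  have ht := time_pos_of_rate_le hN hL hr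
  have hd0 : 0 ≤ max (purchaseAcc N T t) (arrivalAcc T t) :=
    le_max_of_le_right (by unfold arrivalAcc; positivity)
  rw [Prod.norm_def, Prod.norm_def]
  refine max_le ?_ (max_le ?_ ?_)
  · exact (pi_norm_le_iff_of_nonneg hd0).2 fun j =>
      (abs_arrivalEst_sub_le hL ht hlen hf j).trans (le_max_right _ _)
  · exact (pi_norm_le_iff_of_nonneg hd0).2 fun i => (pi_norm_le_iff_of_nonneg hd0).2 fun j =>
      (abs_purchaseEst_sub_le hN hL hr hlen hf i (hp j)).trans (le_max_left _ _)
  · have : (estimate (revenue θ) (formLog sol h) - θ).2.2 = 0 := sub_self _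
    rw [this, norm_zero]
    exact hd0

/-- Inverse-probability weighting can produce values outside $(0,1)$; an error below the margin
$\kappa$ excludes this. Empirical frequencies form a probability vector as soon as one user has
arrived. -/
lemma estimate_mem_instances (hh : h ≠ []) {κ : ℝ}
    (hκ : ∀ i j, purchase θ i j ∈ Set.Icc κ (1 - κ))
    (hd : ‖estimate (revenue θ) (formLog sol h) - θ‖ < κ) :
    estimate (revenue θ) (formLog sol h) ∈ instances M N := by
  refine ⟨arrivalEst_mem_stdSimplex (by simpa using hh), fun i j => ?_⟩
  have h1 := abs_lt.1 ((abs_purchase_sub_le (estimate (revenue θ) (formLog sol h)) θ i j).trans_lt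
    hd)
  have h2 := hκ i j
  constructor <;> linarith [h1.1, h1.2, h2.1, h2.2]

end Accuracy

/-! ### Regret of a single round -/

lemma rpow_neg_third_le_rate (hN : 0 < N) {T t : ℕ} (ht : t < T) (hL : 1 ≤ Real.log T) :
    (T : ℝ) ^ (-(1 / 3) : ℝ) ≤ rate N T t := by
  refine le_trans ?_ (rate_ge hL t)
  have h1 : (1 : ℝ) ≤ (N : ℝ) ^ (1 / 3 : ℝ) :=
    Real.one_le_rpow (by exact_mod_cast hN) (by norm_num)
  have h2 : (T : ℝ) ^ (-(1 / 3) : ℝ) ≤ ((t : ℝ) + 1) ^ (-(1 / 3) : ℝ) :=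
    Real.rpow_le_rpow_of_nonpos (by positivity) (by exact_mod_cast ht) (by norm_num)
  nlinarith [Real.rpow_nonneg (by positivity : (0 : ℝ) ≤ (t : ℝ) + 1) (-(1 / 3))]

lemma time_horizon_pos {T : ℕ} (hL : 1 ≤ Real.log T) : 0 < T := by
  rcases Nat.eq_zero_or_pos T with h | h
  · rw [h] at hL; norm_num at hL
  · exact h

/-- The rate is never below $T^{-1/3}$, so a small rate forces a long horizon. Every lower bound on
$\log T$ by a constant is obtained in this way. -/
lemma lt_log_of_rate_lt (hN : 0 < N) {T t : ℕ} (ht : t < T) (hL : 1 ≤ Real.log T) {l : ℝ}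
    (h : rate N T t < Real.exp (-(l / 3))) : l < Real.log T := by
  have hT : (0 : ℝ) < T := by exact_mod_cast time_horizon_pos hL
  have h1 := (rpow_neg_third_le_rate hN ht hL).trans_lt h
  rw [Real.rpow_def_of_pos hT, Real.exp_lt_exp] at h1
  linarith

section Run

variable {Ω : Type*} [MeasurableSpace Ω] {P : Measure Ω} {θ : Params M N} {T t : ℕ}
  {sol : List (Entry M N) → Mat M N} {o : ℕ → Ω → Obs M N}

lemma IsRun.integral_failureAt_le [IsProbabilityMeasure P] (hrun : IsRun P θ T sol o)
    (hθ : θ ∈ instances M N) (hN : 0 < N) (hsol : ∀ R, sol R ∈ policies M N) (ht : t < T)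
    (hL : 2 ≤ Real.log T) (hr : rate N T t ≤ 1 / 3) :
    ∫ ω, failureAt θ sol T t (hist o t ω) ∂P ≤ 4 * M / T := by
  have hL1 : 1 ≤ Real.log T := by linarith
  have hT : (0 : ℝ) < T := by exact_mod_cast time_horizon_pos hL1
  have ht0 := time_pos_of_rate_le hN hL1 hr
  have ht0' : (0 : ℝ) < t := by exact_mod_cast ht0
  have hm := minArrivals_pos hL1 ht0
  have hε := explore_pos hN t
  have hNT : (N : ℝ) ≤ T := (le_of_rate_lt_one hN hL1 (hr.trans_lt (by norm_num))).trans
    (by exact_mod_cast ht)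
  have hl : |√(Real.log T / t)| ≤ 1 := by
    rw [abs_of_nonneg (Real.sqrt_nonneg _)]
    refine Real.sqrt_le_one.2 ((div_le_one ht0').2 ?_)
    have h1 := time_ge_of_rate_le hN hL1 hr
    have h2 : Real.log T ≤ Real.log T ^ 3 := le_self_pow₀ hL1 (by norm_num)
    linarith
  have hk : |Real.log T * √(explore N (t + 1) / minArrivals T t)| ≤ explore N (t + 1) := by
    rw [abs_of_nonneg (by positivity)]
    refine le_of_sq_le_sq ?_ hε.le
    rw [mul_pow, Real.sq_sqrt (by positivity), mul_div_assoc', div_le_iff₀ hm]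
    have h1 := log_sq_le_rate_sq hN hL1 hr
    have h2 : 4 * rate N T t ^ 2 ≤ 1 := by nlinarith [rate_nonneg N T t]
    have h3 : Real.log T ^ 2 ≤ explore N (t + 1) * minArrivals T t :=
      h1.trans (mul_le_of_le_one_left (by positivity) h2)
    nlinarith
  refine (hrun.integral_le_of_step_le hθ hN hsol (failureAt θ sol T t) ht.le
    fun h hh => ?_).trans ?_
  · exact failure_step_le hθ hN hsol (Real.exp_pos _).le (Real.exp_pos _).le hε hl hk
      (explore_anti N hh.le)
  · rw [failureAt, failure_nil]
    have h1 : Real.exp (-Real.log T) = 1 / T := by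
      rw [Real.exp_neg, Real.exp_log hT, one_div]
    have h2 : Real.exp (-Real.log T ^ 2) ≤ 1 / T * (1 / T) := by
      rw [← h1, ← Real.exp_add]
      -- Here $\log T\ge2$ is used. The weight of the purchase terms is then at most $T^{-2}$, which
      -- outweighs the sum over the $N\le T$ items.
      exact Real.exp_le_exp.2 (by nlinarith)
    have h3 : Real.exp (-Real.log T ^ 2) * N ≤ 1 / T := by
      calc Real.exp (-Real.log T ^ 2) * N ≤ 1 / T * (1 / T) * T := by gcongr
        _ = 1 / T := by field_simp
    rw [h1]
    have h4 := mul_le_mul_of_nonneg_right h3 (Nat.cast_nonneg (α := ℝ) M)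
    have e : 4 * (M : ℝ) / T = 2 * (1 / T) * M + 2 * (1 / T * M) := by ring
    rw [e]
    linarith

/-- Bound for a quantity that is always at most `K`, and at most `A` times the rate if the rate
is below `c` and the estimates are accurate. -/
def roundBound (θ : Params M N) (sol : List (Entry M N) → Mat M N) (T t : ℕ) (A K c : ℝ)
    (h : List (Obs M N)) : ℝ :=
  if rate N T t < c then A * rate N T t + K * failureAt θ sol T t h else K

lemma failureAt_nonneg (h : List (Obs M N)) : 0 ≤ failureAt θ sol T t h :=
  failure_nonneg (Real.exp_pos _).le (Real.exp_pos _).le h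

/-- Markov's inequality in pointwise form: where the failure function is at least one, its multiple
by `K` already covers the trivial bound. -/
lemma le_roundBound {A K c g : ℝ} (hA : 0 ≤ A) (hK : 0 ≤ K) {h : List (Obs M N)} (hgK : g ≤ K)
    (hgA : rate N T t < c → failureAt θ sol T t h < 1 → g ≤ A * rate N T t) :
    g ≤ roundBound θ sol T t A K c h := by
  have hr := rate_nonneg N T t
  have hF := failureAt_nonneg (θ := θ) (sol := sol) (T := T) (t := t) h
  unfold roundBound
  split_ifs with hc
  · by_cases hf : failureAt θ sol T t h < 1
    · exact (hgA hc hf).trans (le_add_of_nonneg_right (by positivity))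
    · have : K ≤ K * failureAt θ sol T t h := le_mul_of_one_le_right hK (not_lt.1 hf)
      have : 0 ≤ A * rate N T t := by positivity
      linarith
  · exact hgK

lemma IsRun.integral_roundBound_le [IsProbabilityMeasure P] (hrun : IsRun P θ T sol o)
    (hθ : θ ∈ instances M N) (hN : 0 < N) (hsol : ∀ R, sol R ∈ policies M N) (ht : t < T)
    (hL : 1 ≤ Real.log T) {A K c : ℝ} (hA : 0 ≤ A) (hK : 0 ≤ K) (hc : 0 < c)
    (hc3 : c ≤ 1 / 3) (hc2 : c ≤ Real.exp (-(2 / 3))) :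
    ∫ ω, roundBound θ sol T t A K c (hist o t ω) ∂P ≤ (A + K / c + 4 * M * K) * rate N T t := by
  have hr := rate_nonneg N T t
  unfold roundBound
  split_ifs with h
  · have hL2 : 2 ≤ Real.log T := (lt_log_of_rate_lt hN ht hL (h.trans_le hc2)).le
    have hF := hrun.integral_failureAt_le hθ hN hsol ht hL2 (h.le.trans hc3)
    have hi : Integrable (fun ω => failureAt θ sol T t (hist o t ω)) P :=
      integrable_comp_hist hrun ht.le (failureAt θ sol T t)
    rw [integral_add (integrable_const _) (hi.const_mul K),
      integral_const_mul K (fun ω => failureAt θ sol T t (hist o t ω))]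
    simp only [integral_const, probReal_univ, smul_eq_mul, one_mul]
    have hT1 : (1 : ℝ) ≤ T := by exact_mod_cast time_horizon_pos hL
    -- The mean of the failure function is of order $M/T$, and $1/T\le T^{-1/3}$ is below the rate.
    have h1 : (1 : ℝ) / T ≤ rate N T t := by
      refine le_trans ?_ (rpow_neg_third_le_rate hN ht hL)
      rw [one_div, ← Real.rpow_neg_one]
      exact Real.rpow_le_rpow_of_exponent_le hT1 (by norm_num)
    have h2 : K * ∫ ω, failureAt θ sol T t (hist o t ω) ∂P ≤ K * (4 * M * rate N T t) := by
      refine mul_le_mul_of_nonneg_left (hF.trans ?_) hK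
      rw [div_eq_mul_one_div]
      gcongr
    have h3 : 0 ≤ K / c * rate N T t := by positivity
    nlinarith
  · simp only [integral_const, probReal_univ, smul_eq_mul, one_mul]
    have h1 : K ≤ K / c * rate N T t := by
      rw [div_mul_eq_mul_div, le_div_iff₀ hc]
      exact mul_le_mul_of_nonneg_left (not_lt.1 h) hK
    have h2 : 0 ≤ (A + 4 * M * K) * rate N T t := by positivity
    nlinarith

/-! ### Summation over the rounds -/

lemma sum_rpow_neg_third_le (T : ℕ) :
    ∑ t ∈ Finset.range T, ((t : ℝ) + 1) ^ (-(1 / 3) : ℝ) ≤ 3 / 2 * (T : ℝ) ^ (2 / 3 : ℝ) := by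
  induction T with
  | zero => simp
  | succ n ih =>
    rw [Finset.sum_range_succ]
    have hn : (0 : ℝ) < (n : ℝ) + 1 := by positivity
    set a := ((n : ℝ) + 1) ^ (1 / 3 : ℝ) with ha
    set b := (n : ℝ) ^ (1 / 3 : ℝ) with hb
    have ha0 : 0 < a := Real.rpow_pos_of_pos hn _
    have hb0 : 0 ≤ b := by positivity
    have e1 : ((n : ℝ) + 1) ^ (-(1 / 3) : ℝ) = 1 / a := by
      rw [Real.rpow_neg hn.le, ← ha, one_div]
    have e2 : ((n + 1 : ℕ) : ℝ) ^ (2 / 3 : ℝ) = a ^ 2 := by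
      rw [ha, ← Real.rpow_mul_natCast hn.le]; push_cast; norm_num
    have e3 : (n : ℝ) ^ (2 / 3 : ℝ) = b ^ 2 := by
      rw [hb, ← Real.rpow_mul_natCast (by positivity)]; norm_num
    have e4 : a ^ 3 = n + 1 := by
      rw [ha, ← Real.rpow_mul_natCast hn.le]; norm_num
    have e5 : b ^ 3 = n := by
      rw [hb, ← Real.rpow_mul_natCast (by positivity)]; norm_num
    rw [e3] at ih
    rw [e1, e2]
    -- After multiplication by $a$ and with $a^3-b^3=1$, the difference of the sides is
    -- $\frac12(a-b)^2(a+2b)$.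
    have key : 1 / a ≤ 3 / 2 * a ^ 2 - 3 / 2 * b ^ 2 := by
      rw [div_le_iff₀ ha0]
      nlinarith [mul_nonneg (sq_nonneg (a - b)) (by positivity : 0 ≤ a + 2 * b)]
    linarith

lemma average_rate_le (hL : 1 ≤ Real.log T) :
    1 / (T : ℝ) * ∑ t ∈ Finset.range T, rate N T t ≤
      3 / 2 * ((N : ℝ) ^ (1 / 3 : ℝ) * (T : ℝ) ^ (-(1 / 3) : ℝ) * Real.log T ^ (3 / 2 : ℝ)) := by
  have hT : (0 : ℝ) < T := by exact_mod_cast time_horizon_pos hL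
  unfold rate
  rw [← Finset.sum_mul, ← Finset.mul_sum]
  have e : (T : ℝ) ^ (-(1 / 3) : ℝ) = 1 / T * (T : ℝ) ^ (2 / 3 : ℝ) := by
    rw [one_div (T : ℝ), ← Real.rpow_neg_one (T : ℝ), ← Real.rpow_add hT]; norm_num
  rw [e]
  calc 1 / (T : ℝ) * ((N : ℝ) ^ (1 / 3 : ℝ) *
        (∑ t ∈ Finset.range T, ((t : ℝ) + 1) ^ (-(1 / 3) : ℝ)) * Real.log T ^ (3 / 2 : ℝ))
      ≤ 1 / (T : ℝ) * ((N : ℝ) ^ (1 / 3 : ℝ) * (3 / 2 * (T : ℝ) ^ (2 / 3 : ℝ)) *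
          Real.log T ^ (3 / 2 : ℝ)) := by
        gcongr; exact sum_rpow_neg_third_le T
    _ = _ := by ring

/-- A random quantity that is dominated by the time average of the round bounds. -/
lemma IsRun.integral_average_roundBound_le [IsProbabilityMeasure P] (hrun : IsRun P θ T sol o)
    (hθ : θ ∈ instances M N) (hN : 0 < N) (hsol : ∀ R, sol R ∈ policies M N)
    (hL : 1 ≤ Real.log T) {A K c : ℝ} (hA : 0 ≤ A) (hK : 0 ≤ K) (hc : 0 < c)
    (hc3 : c ≤ 1 / 3) (hc2 : c ≤ Real.exp (-(2 / 3))) :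
    Integrable (fun ω => 1 / (T : ℝ) *
      ∑ t ∈ Finset.range T, roundBound θ sol T t A K c (hist o t ω)) P ∧
    ∫ ω, 1 / (T : ℝ) * ∑ t ∈ Finset.range T, roundBound θ sol T t A K c (hist o t ω) ∂P ≤
      (A + K / c + 4 * M * K) * (3 / 2 * ((N : ℝ) ^ (1 / 3 : ℝ) * (T : ℝ) ^ (-(1 / 3) : ℝ) *
        Real.log T ^ (3 / 2 : ℝ))) := by
  have hi : ∀ t ∈ Finset.range T,
      Integrable (fun ω => roundBound θ sol T t A K c (hist o t ω)) P := fun t ht =>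
    integrable_comp_hist hrun (Finset.mem_range.1 ht).le (roundBound θ sol T t A K c)
  refine ⟨(integrable_finsetSum _ hi).const_mul _, ?_⟩
  rw [integral_const_mul, integral_finsetSum _ hi]
  calc 1 / (T : ℝ) * ∑ t ∈ Finset.range T,
        ∫ ω, roundBound θ sol T t A K c (hist o t ω) ∂P
      ≤ 1 / (T : ℝ) * ∑ t ∈ Finset.range T, (A + K / c + 4 * M * K) * rate N T t := by
        gcongr with t ht
        exact hrun.integral_roundBound_le hθ hN hsol (Finset.mem_range.1 ht) hL hA hK hc hc3 hc2
    _ = (A + K / c + 4 * M * K) * (1 / (T : ℝ) * ∑ t ∈ Finset.range T, rate N T t) := by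
        rw [← Finset.mul_sum]; ring
    _ ≤ _ := mul_le_mul_of_nonneg_left (average_rate_le hL) (by positivity)

end Run

/-! ### Rounds with accurate estimates -/

section Round

variable {S : Spec M N} {θ : Params M N} {sol : List (Entry M N) → Mat M N} {T t : ℕ}
  {B ζ κ l : ℝ} {xs : Mat M N} {h : List (Obs M N)}

/-- The recommendation before exploration, in a round with accurate estimates. -/
lemma accurate_round (hθ : θ ∈ instances M N) (hM : 0 < M) (hN : 0 < N)
    (hκ : ∀ i j, purchase θ i j ∈ Set.Icc κ (1 - κ)) (hl : ‖S.L θ‖ ≤ l) (hB : 0 ≤ B)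
    (hLip : LocallyLipschitz S θ B ζ) (hxs : IsOptimal S θ 0 xs)
    (hsol : SolvesRelaxed S (revenue θ) T sol) (hp : ∀ j, 1 / Real.log T ≤ arrival θ j)
    (hL : 2 ≤ Real.log T) (hLB : 2 * B * (2 + l) ≤ Real.log T) (hr : rate N T t ≤ 1 / 3)
    (hrζ : 4 * rate N T t ≤ ζ) (hrκ : 4 * rate N T t < κ) (hlen : h.length = t)
    (hf : failureAt θ sol T t h < 1) :
    (∀ rb, ‖revenue θ‖ ≤ rb →
      rev xs θ - rev (sol (formLog sol h)) θ ≤ 16 * rb * M * rate N T t) ∧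
    (∀ i, S.δI * itemOutcome (S.L θ) (S.fI θ) i - itemOutcome (S.L θ) (sol (formLog sol h)) i ≤
      16 * M * Real.log T * rate N T t) ∧
    (∀ j, S.δU * userOutcome (S.U θ) (S.fU θ) j - userOutcome (S.U θ) (sol (formLog sol h)) j ≤
      16 * M * Real.log T * rate N T t) := by
  have hL1 : 1 ≤ Real.log T := by linarith
  have ht := time_pos_of_rate_le hN hL1 hr
  have hl0 : 0 ≤ l := (norm_nonneg _).trans hl
  have hM1 : (1 : ℝ) ≤ M := by exact_mod_cast hM
  have hr0 := rate_nonneg N T t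
  set x := sol (formLog sol h) with hx
  set θ' := estimate (revenue θ) (formLog sol h) with hθ'def
  set d := max (purchaseAcc N T t) (arrivalAcc T t) with hddef
  have hd : ‖θ' - θ‖ ≤ d := norm_estimate_sub_le hN hL1 hr hlen hf hp
  have hd0 : 0 ≤ d := (norm_nonneg _).trans hd
  have hdr : d ≤ 4 * rate N T t :=
    max_le (purchaseAcc_le_rate hN hL1 hr) (arrivalAcc_le_rate hN hL1 hr)
  have hdζ : d ≤ ζ := hdr.trans hrζ
  have hne : h ≠ [] := by rintro rfl; simp at hlen; omega
  have hθ' : θ' ∈ instances M N :=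
    estimate_mem_instances hne hκ ((hd.trans hdr).trans_lt hrκ)
  set g := max (radiusY N T (t + 1)) (radiusP T (t + 1)) with hg
  have hg0 : 0 ≤ g := le_max_of_le_right (by unfold radiusP; positivity)
  have hdg : d ≤ 2 * g := by
    refine max_le ((purchaseAcc_le_radiusY hN hL1 hr).trans ?_)
      ((arrivalAcc_le_radiusP hL1 ht).trans ?_)
    · have := le_max_left (radiusY N T (t + 1)) (radiusP T (t + 1)); linarith
    · have := le_max_right (radiusY N T (t + 1)) (radiusP T (t + 1)); linarith
  have hgr : g ≤ 8 * rate N T t := by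
    refine max_le ?_ (radiusP_le_rate hN hL hr)
    have := (radiusY_le_purchaseAcc hN hL1 hr).trans (purchaseAcc_le_rate hN hL1 hr)
    linarith
  have hη : relax M N T (t + 1) = M * Real.log T * g := rfl
  -- The factor $\log T$ in the relaxation stands in for the unknown Lipschitz constant: it exceeds
  -- $2B(2+l)$, the two coming from $d\le2g$.
  have hBd : B * d * (2 + l) ≤ Real.log T * g := by
    calc B * d * (2 + l) ≤ B * (2 * g) * (2 + l) := by gcongr
      _ = 2 * B * (2 + l) * g := by ring
      _ ≤ Real.log T * g := by gcongr
  have hη1 : M * (B * d * (2 + l)) ≤ relax M N T (t + 1) := by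
    rw [hη, mul_assoc (M : ℝ)]
    exact mul_le_mul_of_nonneg_left hBd (by positivity)
  have hη2 : 2 * (B * d) ≤ relax M N T (t + 1) := by
    have h1 : 0 ≤ B * d := by positivity
    have h2 : 1 * (Real.log T * g) ≤ M * (Real.log T * g) := by gcongr
    rw [hη, mul_assoc]
    nlinarith
  have hη3 : relax M N T (t + 1) ≤ 8 * M * Real.log T * rate N T t := by
    rw [hη]
    calc M * Real.log T * g ≤ M * Real.log T * (8 * rate N T t) := by gcongr
      _ = 8 * M * Real.log T * rate N T t := by ring
  have hfeas : Feasible S θ' (relax M N T (t + 1)) xs :=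
    hxs.1.perturb hθ hθ' hLip hB hd hdζ hl hη1 hη2
  have hsolR := hsol (formLog sol h)
  -- A log of length `t` precedes round `t + 1`, whose relaxation is the one bounded above.
  rw [length_formLog, hlen] at hsolR
  have hopt : IsOptimal S θ' (relax M N T (t + 1)) x := hsolR.2 hθ' ⟨xs, hfeas⟩
  have hxmem : x ∈ policies M N := hsolR.1
  refine ⟨fun rb hrb => ?_, fun i => ?_, fun j => ?_⟩
  · have hrb0 : 0 ≤ rb := (norm_nonneg _).trans hrb
    have h1 := (abs_le.1 (abs_rev_sub_rev_le hθ hθ' rfl hrb hd hxs.1.1)).1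
    have h2 := (abs_le.1 (abs_rev_sub_rev_le hθ hθ' rfl hrb hd hxmem)).2
    have h3 := hopt.2 xs hfeas
    -- The two changes of instance, for `xs` and for `x`, each cost this much; $M+1\le2M$ and
    -- $d\le4\rho$ give the constant 16.
    have h4 : rb * d * (M + 1) ≤ rb * (4 * rate N T t) * (M + M) := by gcongr
    nlinarith
  · have h1 := (abs_le.1 (item_constraint_perturb hθ' hLip hB hd hdζ hl hxmem i)).2
    have h2 := hopt.1.2.1 i
    linarith
  · have h1 := (abs_le.1 (user_constraint_perturb hθ hθ' hLip hB hd hdζ hxmem j)).2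
    have h2 := hopt.1.2.2 j
    linarith

/-! ### Effect of exploration on revenue and outcomes -/

lemma abs_rev_recAfter_sub_le (hθ : θ ∈ instances M N) (hN : 0 < N) {r : ℝ}
    (hr : ‖revenue θ‖ ≤ r) (hsol : ∀ R, sol R ∈ policies M N) (hL : 1 ≤ Real.log T)
    (hlen : h.length = t) :
    |rev (recAfter sol h) θ - rev (sol (formLog sol h)) θ| ≤ 2 * r * rate N T t := by
  have hr0 : 0 ≤ r := (norm_nonneg _).trans hr
  rw [rev_eq_sum_users, rev_eq_sum_users, ← Finset.sum_sub_distrib]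
  simp only [← mul_sub]
  refine abs_sum_arrival_mul_le hθ fun j => ?_
  refine le_trans ?_ (mul_le_mul_of_nonneg_left (mul_explore_le_rate hN hL t) (by positivity))
  have := abs_sum_mul_explore_le (explore_pos hN t).le hr0
    (fun i => abs_revenue_mul_purchase_le hθ hr i j) (hsol (formLog sol h) j)
  simpa [recAfter, nextRec, hlen] using this

lemma abs_userOutcome_recAfter_sub_le {U : Mat M N} (hN : 0 < N) {u : ℝ} (hu : ‖U‖ ≤ u)
    (hsol : ∀ R, sol R ∈ policies M N) (hL : 1 ≤ Real.log T) (hlen : h.length = t) (j : Fin M) :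
    |userOutcome U (recAfter sol h) j - userOutcome U (sol (formLog sol h)) j| ≤
      2 * u * rate N T t := by
  have hu0 : 0 ≤ u := (norm_nonneg _).trans hu
  refine le_trans ?_ (mul_le_mul_of_nonneg_left (mul_explore_le_rate hN hL t) (by positivity))
  have := abs_sum_mul_explore_le (explore_pos hN t).le hu0
    (fun i => (abs_entry_le_norm U i j).trans hu) (hsol (formLog sol h) j)
  simpa [userOutcome, recAfter, nextRec, hlen] using this

lemma abs_itemOutcome_recAfter_sub_le {L : Mat M N} (hN : 0 < N) (hl : ‖L‖ ≤ l)
    (hsol : ∀ R, sol R ∈ policies M N) (hL : 1 ≤ Real.log T) (hlen : h.length = t) (i : Fin N) :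
    |itemOutcome L (recAfter sol h) i - itemOutcome L (sol (formLog sol h)) i| ≤
      M * (l * rate N T t) := by
  refine (abs_itemOutcome_sub_le (a := 0) (b := rate N T t) (by simp) (fun i j => ?_)
    (fun i j => (abs_entry_le_norm L i j).trans hl) (hsol _) i).trans_eq (by ring)
  refine le_trans ?_ (mul_explore_le_rate hN hL t)
  have hε := explore_pos hN t
  have h0 : 0 ≤ sol (formLog sol h) i j := (hsol (formLog sol h) j).1 i
  have h1 := policies_le_one (hsol (formLog sol h)) i j
  have hN' : (1 : ℝ) ≤ N := by exact_mod_cast hN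
  have h2 : explore N (t + 1) ≤ N * explore N (t + 1) := le_mul_of_one_le_left hε.le hN'
  have e : recAfter sol h i j - sol (formLog sol h) i j =
      explore N (t + 1) - N * explore N (t + 1) * sol (formLog sol h) i j := by
    simp only [recAfter, nextRec, length_formLog, hlen]; ring
  have h3 : 0 ≤ N * explore N (t + 1) := hε.le.trans h2
  rw [e, abs_le]
  constructor <;> nlinarith

end Round

/-! ### Trivial bounds on outcomes and constraint violations -/

lemma abs_itemOutcome_le {L x : Mat M N} {l : ℝ} (hl : ‖L‖ ≤ l) (hx : x ∈ policies M N)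
    (i : Fin N) : |itemOutcome L x i| ≤ M * l := by
  refine abs_sum_le_card_mul fun j => ?_
  have h0 : 0 ≤ x i j := (hx j).1 i
  rw [abs_mul, abs_of_nonneg h0]
  exact (mul_le_of_le_one_right (abs_nonneg _) (policies_le_one hx i j)).trans
    ((abs_entry_le_norm L i j).trans hl)

lemma abs_userOutcome_le {U x : Mat M N} {u : ℝ} (hu : ‖U‖ ≤ u) (hx : x ∈ policies M N)
    (j : Fin M) : |userOutcome U x j| ≤ u :=
  abs_sum_mul_policies_le hx fun i => (abs_entry_le_norm U i j).trans hu

lemma IsUserFair.mem_policies {U f : Mat M N} (hf : IsUserFair U f) : f ∈ policies M N := by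
  intro j
  obtain ⟨k, -, hk⟩ := hf j
  refine ⟨fun i => ?_, by simp [hk]⟩
  simp only [hk]
  split_ifs <;> norm_num

lemma mul_sub_le_of_abs_le {δ a b c : ℝ} (hδ : δ ∈ Set.Icc (0 : ℝ) 1) (ha : |a| ≤ c)
    (hb : |b| ≤ c) : δ * a - b ≤ 2 * c := by
  have h1 : |δ * a| ≤ |a| := by
    rw [abs_mul, abs_of_nonneg hδ.1]; exact mul_le_of_le_one_left (abs_nonneg a) hδ.2
  linarith [le_abs_self (δ * a), neg_abs_le b]

/-! ### Regret of the algorithm -/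

section Regret

variable {S : Spec M N} {θ : Params M N} {sol : List (Entry M N) → Mat M N} {T : ℕ}
  {B ζ κ r l u c : ℝ} {xs : Mat M N}
  {Ω : Type*} [MeasurableSpace Ω] {P : Measure Ω} [IsProbabilityMeasure P]
  {o : ℕ → Ω → Obs M N}

lemma IsRun.integral_revenueRegret_le (hrun : IsRun P θ T sol o)
    (hθ : θ ∈ instances M N) (hM : 0 < M) (hN : 0 < N)
    (hκ : ∀ i j, purchase θ i j ∈ Set.Icc κ (1 - κ)) (hr : ‖revenue θ‖ ≤ r)
    (hl : ‖S.L θ‖ ≤ l) (hB : 0 ≤ B) (hLip : LocallyLipschitz S θ B ζ)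
    (hxs : IsOptimal S θ 0 xs) (hsol : SolvesRelaxed S (revenue θ) T sol)
    (hp : ∀ j, 1 / Real.log T ≤ arrival θ j) (hL : 1 ≤ Real.log T)
    (hc : 0 < c) (hc3 : c ≤ 1 / 3) (hcζ : 4 * c ≤ ζ) (hcκ : 4 * c ≤ κ)
    (hc2 : c ≤ Real.exp (-(2 / 3))) (hcB : c ≤ Real.exp (-(2 * B * (2 + l) / 3))) :
    ∫ ω, revenueRegret θ T xs (fun t => recAfter sol (hist o t ω)) ∂P ≤
      3 / 2 * (26 * r + 2 * r / c) * M * (N : ℝ) ^ (1 / 3 : ℝ) * (T : ℝ) ^ (-(1 / 3) : ℝ) *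
        Real.log T ^ (3 / 2 : ℝ) := by
  have hsol' : ∀ R, sol R ∈ policies M N := fun R => (hsol R).1
  have hr0 : 0 ≤ r := (norm_nonneg _).trans hr
  have hM1 : (1 : ℝ) ≤ M := by exact_mod_cast hM
  obtain ⟨hint, hbound⟩ := hrun.integral_average_roundBound_le hθ hN hsol' hL
    (by positivity : 0 ≤ 18 * r * M) (by positivity : 0 ≤ 2 * r) hc hc3 hc2
  have hint' : Integrable
      (fun ω => revenueRegret θ T xs (fun t => recAfter sol (hist o t ω))) P := by
    unfold revenueRegret
    refine (integrable_finsetSum _ fun t ht => ?_).const_mul _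
    exact integrable_comp_hist hrun (Finset.mem_range.1 ht).le
      (fun h => rev xs θ - rev (recAfter sol h) θ)
  have hle : ∀ ω, revenueRegret θ T xs (fun t => recAfter sol (hist o t ω)) ≤
      1 / (T : ℝ) * ∑ t ∈ Finset.range T,
        roundBound θ sol T t (18 * r * M) (2 * r) c (hist o t ω) := by
    intro ω
    unfold revenueRegret
    gcongr with t ht
    have ht' := Finset.mem_range.1 ht
    refine le_roundBound (by positivity) (by positivity) ?_ fun hrate hf => ?_
    · have h1 := abs_le.1 (abs_rev_le hθ hr hxs.1.1)
      have h2 := abs_le.1 (abs_rev_le hθ hr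
        (nextRec_mem_policies hN (hsol' (formLog sol (hist o t ω)))))
      unfold recAfter
      linarith [h1.2, h2.1]
    · have hL2 := (lt_log_of_rate_lt hN ht' hL (hrate.trans_le hc2)).le
      have hLB := (lt_log_of_rate_lt hN ht' hL (hrate.trans_le hcB)).le
      have h1 := (accurate_round hθ hM hN hκ hl hB hLip hxs hsol hp hL2 hLB
        (hrate.le.trans hc3) (by linarith) (by linarith) (length_hist o t ω) hf).1 r hr
      have h2 := (abs_le.1 (abs_rev_recAfter_sub_le hθ hN hr hsol' hL (length_hist o t ω))).1
      have h3 : 2 * r * rate N T t * 1 ≤ 2 * r * rate N T t * M :=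
        mul_le_mul_of_nonneg_left hM1 (mul_nonneg (by positivity) (rate_nonneg N T t))
      linarith
  refine (integral_mono hint' hint hle).trans (hbound.trans ?_)
  have hX : 0 ≤ (N : ℝ) ^ (1 / 3 : ℝ) * (T : ℝ) ^ (-(1 / 3) : ℝ) * Real.log T ^ (3 / 2 : ℝ) := by
    positivity
  have h1 : 2 * r / c ≤ 2 * r / c * M := le_mul_of_one_le_right (by positivity) hM1
  have h2 : 18 * r * M + 2 * r / c + 4 * M * (2 * r) ≤ (26 * r + 2 * r / c) * M := by linarith
  refine (mul_le_mul_of_nonneg_right h2 (by positivity)).trans_eq ?_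
  ring

lemma IsRun.integral_fairnessRegret_le (hrun : IsRun P θ T sol o)
    (hθ : θ ∈ instances M N) (hM : 0 < M) (hN : 0 < N)
    (hκ : ∀ i j, purchase θ i j ∈ Set.Icc κ (1 - κ))
    (hl : ‖S.L θ‖ ≤ l) (hu : ‖S.U θ‖ ≤ u) (hB : 0 ≤ B) (hLip : LocallyLipschitz S θ B ζ)
    (hxs : IsOptimal S θ 0 xs) (hsol : SolvesRelaxed S (revenue θ) T sol)
    (hp : ∀ j, 1 / Real.log T ≤ arrival θ j) (hL : 1 ≤ Real.log T) (hML : M ≤ Real.log T)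
    (hc : 0 < c) (hc3 : c ≤ 1 / 3) (hcζ : 4 * c ≤ ζ) (hcκ : 4 * c ≤ κ)
    (hc2 : c ≤ Real.exp (-(2 / 3))) (hcB : c ≤ Real.exp (-(2 * B * (2 + l) / 3))) :
    ∫ ω, fairnessRegret S θ T (fun t => recAfter sol (hist o t ω)) ∂P ≤
      3 / 2 * (16 + 9 * l + 10 * u + 2 * (l + u) / c) * M * (N : ℝ) ^ (1 / 3 : ℝ) *
        (T : ℝ) ^ (-(1 / 3) : ℝ) * Real.log T ^ (5 / 2 : ℝ) := by
  have hsol' : ∀ R, sol R ∈ policies M N := fun R => (hsol R).1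
  have hrec : ∀ h, recAfter sol h ∈ policies M N := fun h => nextRec_mem_policies hN (hsol' _)
  have hl0 : 0 ≤ l := (norm_nonneg _).trans hl
  have hu0 : 0 ≤ u := (norm_nonneg _).trans hu
  have hM1 : (1 : ℝ) ≤ M := by exact_mod_cast hM
  have : Nonempty (Fin M) := ⟨⟨0, hM⟩⟩
  have : Nonempty (Fin N) := ⟨⟨0, hN⟩⟩
  set A := (16 + l + 2 * u) * M * Real.log T with hA
  set K := 2 * M * (l + u) with hK
  have hA0 : 0 ≤ A := by positivity
  have hK0 : 0 ≤ K := by positivity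
  obtain ⟨hint, hbound⟩ := hrun.integral_average_roundBound_le hθ hN hsol' hL hA0 hK0 hc hc3 hc2
  have hML1 : 1 ≤ M * Real.log T := one_le_mul_of_one_le_of_one_le hM1 hL
  have hitem : ∀ ω t, t < T → ∀ i,
      max (S.δI * itemOutcome (S.L θ) (S.fI θ) i -
        itemOutcome (S.L θ) (recAfter sol (hist o t ω)) i) 0 ≤
          roundBound θ sol T t A K c (hist o t ω) := by
    intro ω t ht i
    have hrate0 := rate_nonneg N T t
    refine le_roundBound hA0 hK0 (max_le ?_ hK0) fun hrate hf => max_le ?_ (by positivity)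
    · refine (mul_sub_le_of_abs_le S.δI_mem (abs_itemOutcome_le hl (S.itemFair θ hθ).1 i)
        (abs_itemOutcome_le hl (hrec _) i)).trans ?_
      rw [hK]
      nlinarith
    · have hL2 := (lt_log_of_rate_lt hN ht hL (hrate.trans_le hc2)).le
      have hLB := (lt_log_of_rate_lt hN ht hL (hrate.trans_le hcB)).le
      have h1 := (accurate_round hθ hM hN hκ hl hB hLip hxs hsol hp hL2 hLB
        (hrate.le.trans hc3) (by linarith) (by linarith) (length_hist o t ω) hf).2.1 i
      have h2 := (abs_le.1 (abs_itemOutcome_recAfter_sub_le hN hl hsol' hL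
        (length_hist o t ω) i)).1
      have h3 : M * (l * rate N T t) * 1 ≤ M * (l * rate N T t) * Real.log T :=
        mul_le_mul_of_nonneg_left hL (by positivity)
      have h4 : 0 ≤ 2 * u * M * Real.log T * rate N T t := by positivity
      rw [hA]
      linarith
  have huser : ∀ ω t, t < T → ∀ j,
      max (S.δU * userOutcome (S.U θ) (S.fU θ) j -
        userOutcome (S.U θ) (recAfter sol (hist o t ω)) j) 0 ≤
          roundBound θ sol T t A K c (hist o t ω) := by
    intro ω t ht j
    have hrate0 := rate_nonneg N T t
    refine le_roundBound hA0 hK0 (max_le ?_ hK0) fun hrate hf => max_le ?_ (by positivity)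
    · refine (mul_sub_le_of_abs_le S.δU_mem
        (abs_userOutcome_le hu (S.userFair θ hθ).mem_policies j)
        (abs_userOutcome_le hu (hrec _) j)).trans ?_
      rw [hK]
      nlinarith
    · have hL2 := (lt_log_of_rate_lt hN ht hL (hrate.trans_le hc2)).le
      have hLB := (lt_log_of_rate_lt hN ht hL (hrate.trans_le hcB)).le
      have h1 := (accurate_round hθ hM hN hκ hl hB hLip hxs hsol hp hL2 hLB
        (hrate.le.trans hc3) (by linarith) (by linarith) (length_hist o t ω) hf).2.2 j
      have h2 := (abs_le.1 (abs_userOutcome_recAfter_sub_le hN hu hsol' hL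
        (length_hist o t ω) j)).1
      have h3 : 2 * u * rate N T t * 1 ≤ 2 * u * rate N T t * (M * Real.log T) :=
        mul_le_mul_of_nonneg_left hML1 (by positivity)
      have h4 : 0 ≤ l * M * Real.log T * rate N T t := by positivity
      rw [hA]
      linarith
  have hle : ∀ ω, fairnessRegret S θ T (fun t => recAfter sol (hist o t ω)) ≤
      1 / (T : ℝ) * ∑ t ∈ Finset.range T, roundBound θ sol T t A K c (hist o t ω) := by
    intro ω
    refine max_le (ciSup_le fun i => ?_) (ciSup_le fun j => ?_)
    · gcongr with t ht
      exact hitem ω t (Finset.mem_range.1 ht) i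
    · gcongr with t ht
      exact huser ω t (Finset.mem_range.1 ht) j
  have hnonneg : ∀ ω, 0 ≤ fairnessRegret S θ T (fun t => recAfter sol (hist o t ω)) := by
    intro ω
    refine le_max_of_le_left (Real.iSup_nonneg fun i => ?_)
    exact mul_nonneg (by positivity) (Finset.sum_nonneg fun t _ => le_max_right _ _)
  -- Nonnegativity of the regret replaces a proof of its integrability; only the dominating average
  -- has to be integrable.
  refine (integral_mono_of_nonneg (.of_forall hnonneg) hint (.of_forall hle)).trans
    (hbound.trans ?_)
  have hLpos : 0 < Real.log T := by linarith
  have e : Real.log T ^ (5 / 2 : ℝ) = Real.log T * Real.log T ^ (3 / 2 : ℝ) := by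
    nth_rewrite 2 [← Real.rpow_one (Real.log T)]
    rw [← Real.rpow_add hLpos]; norm_num
  have h1 : K / c ≤ 2 * (l + u) / c * (M * Real.log T) := by
    rw [hK, show 2 * (M : ℝ) * (l + u) / c = 2 * (l + u) / c * (M * 1) by ring]
    gcongr
  -- The trivial bound `K` already contains $M$, so the failure term is of order $M^2$; one factor
  -- $M$ is traded for $\log T$.
  have h2 : 4 * M * K ≤ 8 * (l + u) * (M * Real.log T) := by
    rw [hK, show 4 * (M : ℝ) * (2 * M * (l + u)) = 8 * (l + u) * (M * M) by ring]
    gcongr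
  have h3 : A + K / c + 4 * M * K ≤
      (16 + 9 * l + 10 * u + 2 * (l + u) / c) * (M * Real.log T) := by
    rw [hA]; linarith
  rw [e]
  refine (mul_le_mul_of_nonneg_right h3 (by positivity)).trans_eq ?_
  ring

end Regret

/-! ### Consequences of the lower bound on the arrival probabilities -/

lemma inv_log_le_arrival {θ : Params M N} (hM : 0 < M) (hpos : ∀ j, 0 < arrival θ j) {b : ℝ}
    (h : 1 / ⨅ j, arrival θ j < b) (j : Fin M) : 1 / b ≤ arrival θ j := by
  have : Nonempty (Fin M) := ⟨⟨0, hM⟩⟩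
  obtain ⟨k, hk⟩ := exists_eq_ciInf_of_finite (f := arrival θ)
  have h0 : 0 < ⨅ j, arrival θ j := hk ▸ hpos k
  have hle : ⨅ j, arrival θ j ≤ arrival θ j := ciInf_le (Set.finite_range _).bddBelow j
  refine le_trans ?_ hle
  rw [one_div_le ((one_div_pos.2 h0).trans h) h0]
  exact h.le

lemma card_le_of_inv_le_arrival {θ : Params M N} (hθ : θ ∈ instances M N) {b : ℝ} (hb : 0 < b)
    (h : ∀ j, 1 / b ≤ arrival θ j) : (M : ℝ) ≤ b := by
  have h1 : ∑ j, arrival θ j = 1 := hθ.1.2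
  have h2 : ∑ _j : Fin M, 1 / b ≤ ∑ j, arrival θ j := Finset.sum_le_sum fun j _ => h j
  rw [h1] at h2
  simp only [Finset.sum_const, Finset.card_univ, Fintype.card_fin, nsmul_eq_mul] at h2
  rwa [mul_one_div, div_le_one hb] at h2

lemma card_types_pos {θ : Params M N} (hθ : θ ∈ instances M N) : 0 < M := by
  rcases Nat.eq_zero_or_pos M with rfl | h
  · have h1 : ∑ j, arrival θ j = 1 := hθ.1.2
    simp at h1
  · exact h

lemma card_items_pos (hM : 0 < M) {x : Mat M N} (hx : x ∈ policies M N) : 0 < N := by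
  rcases Nat.eq_zero_or_pos N with rfl | h
  · have h1 : ∑ i, x i ⟨0, hM⟩ = 1 := (hx ⟨0, hM⟩).2
    simp at h1
  · exact h

end FairRec

end

theorem theorem1 (rbar Lbar Ubar B ζ κ : ℝ) (hB : 0 < B) (hζ : 0 < ζ) (hκ : 0 < κ) :
    ∃ C : ℝ, 0 < C ∧
      ∀ (M N : ℕ) (S : FairRec.Spec M N) (θ : FairRec.Params M N) (xs : FairRec.Mat M N),
        θ ∈ FairRec.instances M N →
        (∀ j, 0 < FairRec.arrival θ j) →
        (∀ i j, FairRec.purchase θ i j ∈ Set.Icc κ (1 - κ)) →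
        ‖FairRec.revenue θ‖ ≤ rbar → ‖S.L θ‖ ≤ Lbar → ‖S.U θ‖ ≤ Ubar →
        FairRec.LocallyLipschitz S θ B ζ →
        FairRec.IsOptimal S θ 0 xs →
        ∀ T : ℕ,
          max ((2 + ‖FairRec.revenue θ‖) * B) (1 / ⨅ j, FairRec.arrival θ j) < Real.log T →
          ∀ sol : List (FairRec.Entry M N) → FairRec.Mat M N,
            FairRec.SolvesRelaxed S (FairRec.revenue θ) T sol →
            ∀ (Ω : Type*) [MeasurableSpace Ω] (P : MeasureTheory.Measure Ω)
              [MeasureTheory.IsProbabilityMeasure P] (o : ℕ → Ω → FairRec.Obs M N),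
              FairRec.IsRun P θ T sol o →
              (∫ ω, FairRec.revenueRegret θ T xs
                  (fun t => FairRec.recAfter sol (FairRec.hist o t ω)) ∂P
                ≤ C * M * (N : ℝ) ^ (1 / 3 : ℝ) * (T : ℝ) ^ (-(1 / 3) : ℝ) *
                    Real.log T ^ (3 / 2 : ℝ)) ∧
              (∫ ω, FairRec.fairnessRegret S θ T
                  (fun t => FairRec.recAfter sol (FairRec.hist o t ω)) ∂P
                ≤ C * M * (N : ℝ) ^ (1 / 3 : ℝ) * (T : ℝ) ^ (-(1 / 3) : ℝ) *
                    Real.log T ^ (5 / 2 : ℝ)) := by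
  -- The constant is chosen before any instance is given, so the signs of the prescribed bounds are
  -- unknown; absolute values keep it positive.
  set r := |rbar|
  set l := |Lbar|
  set u := |Ubar|
  have hr0 : 0 ≤ r := abs_nonneg _
  have hl0 : 0 ≤ l := abs_nonneg _
  have hu0 : 0 ≤ u := abs_nonneg _
  -- Below $c$ the rate is small enough for four purposes: $t\ge16(\log T)^3$, an error $4\rho$
  -- inside the Lipschitz ball, an error $4\rho$ below the margin $\kappa$, and, through the two
  -- exponentials, $\log T$ above $2$ and above $2B(2+l)$.
  obtain ⟨c, hc, hc3, hcζ, hcκ, hc2, hcB⟩ : ∃ c : ℝ, 0 < c ∧ c ≤ 1 / 3 ∧ 4 * c ≤ ζ ∧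
      4 * c ≤ κ ∧ c ≤ Real.exp (-(2 / 3)) ∧ c ≤ Real.exp (-(2 * B * (2 + l) / 3)) := by
    have h : ∀ᶠ c : ℝ in nhdsWithin 0 (Set.Ioi 0), c ≤ min (min (1 / 3) (min (ζ / 4) (κ / 4)))
        (min (Real.exp (-(2 / 3))) (Real.exp (-(2 * B * (2 + l) / 3)))) :=
      nhdsWithin_le_nhds (eventually_le_nhds (by positivity))
    obtain ⟨c, hc, hc0⟩ := (h.and self_mem_nhdsWithin).exists
    simp only [le_min_iff] at hc
    obtain ⟨⟨h1, h2, h3⟩, h4, h5⟩ := hc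
    exact ⟨c, hc0, h1, by linarith, by linarith, h4, h5⟩
  have hC1 : 0 ≤ 3 / 2 * (26 * r + 2 * r / c) := by positivity
  have hC2 : 0 < 3 / 2 * (16 + 9 * l + 10 * u + 2 * (l + u) / c) := by positivity
  refine ⟨3 / 2 * (26 * r + 2 * r / c) + 3 / 2 * (16 + 9 * l + 10 * u + 2 * (l + u) / c),
    by positivity, ?_⟩
  intro M N S θ xs hθ hpos hy hrev hL hU hLip hxs T hT sol hsol Ω _ P _ o hrun
  have hM := FairRec.card_types_pos hθ
  have hN := FairRec.card_items_pos hM hxs.1.1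
  have hT' := (le_max_right _ _).trans_lt hT
  have hp := FairRec.inv_log_le_arrival hM hpos hT'
  have hlog : 0 < Real.log T :=
    (one_div_nonneg.2 (Real.iInf_nonneg fun j => (hpos j).le)).trans_lt hT'
  have hML := FairRec.card_le_of_inv_le_arrival hθ hlog hp
  have hlog1 : 1 ≤ Real.log T := le_trans (by exact_mod_cast hM) hML
  constructor
  · refine (hrun.integral_revenueRegret_le hθ hM hN hy (hrev.trans (le_abs_self _))
      (hL.trans (le_abs_self _)) hB.le hLip hxs hsol hp hlog1 hc hc3 hcζ hcκ hc2 hcB).trans ?_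
    gcongr
    exact le_add_of_nonneg_right hC2.le
  · refine (hrun.integral_fairnessRegret_le hθ hM hN hy (hL.trans (le_abs_self _))
      (hU.trans (le_abs_self _)) hB.le hLip hxs hsol hp hlog1 hML hc hc3 hcζ hcκ hc2
      hcB).trans ?_
    gcongr
    exact le_add_of_nonneg_left hC1
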